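/- **Theorem 3.1 (doubling).** Write $B_r=B_r(0)\subset\mathbb{R}^n$ for the open ball. Let $\sigma_k(\lambda)$ denote the $k$-th elementary symmetric function of $\lambda\in\mathbb{R}^n$, let $\lambda(D^2u)$ be the vector of eigenvalues of the Hessian $D^2u$, and call $u\in C^2$ *2-convex* if $\sigma_1(\lambda(D^2u))>0$ and $\sigma_2(\lambda(D^2u))>0$ at every point. Let $\psi:B_4\times\mathbb{R}\to\mathbb{R}$ be a positive function and let $u\in C^4(B_4)$ be a 2-convex solution of $$\frac{\sigma_2}{\sigma_1}(D^2u)=\frac{\sigma_2(\lambda(D^2u))}{\sigma_1(\lambda(D^2u))}=\psi(x,u)\qquad\text{in } B_4 .$$ Suppose that $\|u\|_{C^1(B_3)}\le M$ and that $\psi$ is differentiable at the points of $B_3\times[-M,M]$ with $\|\psi\|_{C^{1,1}}\le K$ and $\|1/\psi\|_{L^\infty}\le L$ on $B_3\times[-M,M]$. (i) If $$\frac{\lambda_{\min}(D^2u)}{\Delta u}\ \ge\ -c_n\quad\text{in } B_4,\qquad c_n:=\frac{\sqrt{3n^2+1}-n+1}{2n},$$ then $\Delta u$ is bounded above on $B_2$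 and $$\sup_{B_2}\Delta u\ \le\ C\Bigl(1+\sup_{B_1}\Delta u\Bigr),$$ where $C>0$ depends only on $n,M,K,L$. (ii) If instead $u$ is semi-convex, that is, $u+A|x|^2$ is convex in $B_4$ for some constant $A>0$, then the same conclusion holds with a constant $C>0$ depending only on $n,M,K,L$ and $A$. Here $\|u\|_{C^1}\le M$ means that $|u|$ and $|\nabla u|$ are at most $M$, and $\|\psi\|_{C^{1,1}}\le K$ means that $|\psi|$, $|D\psi|$ and the Lipschitz constant of $D\psi$ are at most $K$. -/

import Mathlib

open Set Metric

noncomputable section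

namespace HessianQuotient

/-- The Hessian matrix `D²u(x)`, with entries `∂ᵢ∂ⱼu(x)` in the standard coordinates. -/
def hessian {n : ℕ} (u : EuclideanSpace ℝ (Fin n) → ℝ) (x : EuclideanSpace ℝ (Fin n)) :
    Matrix (Fin n) (Fin n) ℝ :=
  Matrix.of fun i j => iteratedFDeriv ℝ 2 u x
    ![EuclideanSpace.basisFun (Fin n) ℝ i, EuclideanSpace.basisFun (Fin n) ℝ j]

/-- The Hessian matrix of a `C²` function is symmetric. -/
theorem hessian_isHermitian {n : ℕ} {u : EuclideanSpace ℝ (Fin n) → ℝ}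
    {x : EuclideanSpace ℝ (Fin n)} (hu : ContDiffAt ℝ 2 u x) : (hessian u x).IsHermitian := by
  have h : IsSymmSndFDerivAt ℝ u x := hu.isSymmSndFDerivAt (by simp)
  ext i j
  simpa [hessian, Matrix.conjTranspose_apply, iteratedFDeriv_two_apply] using h _ _

open Classical in
/-- The vector `λ(A) = (λ₁, …, λₙ)` of eigenvalues of a real symmetric matrix, with multiplicity.
A matrix that is not symmetric gets the value `0`; this never happens for the Hessian of a
`C²` function, by `hessian_isHermitian`. -/
def eigenvalueVector {n : ℕ} (A : Matrix (Fin n) (Fin n) ℝ) : Fin n → ℝ :=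
  if h : A.IsHermitian then h.eigenvalues else 0

/-- The `k`-th elementary symmetric function `σₖ(λ)` of `λ ∈ ℝⁿ`. -/
def sigma {n : ℕ} (k : ℕ) (lam : Fin n → ℝ) : ℝ :=
  ∑ s ∈ Finset.powersetCard k (Finset.univ : Finset (Fin n)), ∏ i ∈ s, lam i

/-- The Gårding cone `Γₖ = {λ ∈ ℝⁿ : σⱼ(λ) > 0, j = 1, …, k}`. -/
def gardingCone (n k : ℕ) : Set (Fin n → ℝ) :=
  {lam | ∀ j : ℕ, 1 ≤ j → j ≤ k → 0 < sigma j lam}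

/-- `u` is `k`-convex on the open set `s`: it is `C²` there and `λ(D²u) ∈ Γₖ` at every point. -/
def IsKConvexOn {n : ℕ} (k : ℕ) (u : EuclideanSpace ℝ (Fin n) → ℝ)
    (s : Set (EuclideanSpace ℝ (Fin n))) : Prop :=
  ContDiffOn ℝ 2 u s ∧ ∀ x ∈ s, eigenvalueVector (hessian u x) ∈ gardingCone n k

/-- `u ∈ C⁴(s)` is a `2`-convex solution of `(σ₂/σ₁)(D²u) = ψ(x, u)` on the open set `s`. -/
structure IsTwoConvexSolutionOn {n : ℕ} (ψ : EuclideanSpace ℝ (Fin n) × ℝ → ℝ)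
    (u : EuclideanSpace ℝ (Fin n) → ℝ) (s : Set (EuclideanSpace ℝ (Fin n))) : Prop where
  contDiffOn : ContDiffOn ℝ 4 u s
  twoConvex : IsKConvexOn 2 u s
  equation : ∀ x ∈ s,
    sigma 2 (eigenvalueVector (hessian u x)) / sigma 1 (eigenvalueVector (hessian u x))
      = ψ (x, u x)

/-- The smallest eigenvalue of a real symmetric matrix of positive size. -/
def lambdaMin {n : ℕ} (A : Matrix (Fin n) (Fin n) ℝ) : ℝ :=
  ⨅ i, eigenvalueVector A i

/-- The constant `cₙ = (√(3n² + 1) - n + 1) / (2n)`. -/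
def cConst (n : ℕ) : ℝ :=
  (Real.sqrt (3 * (n : ℝ) ^ 2 + 1) - n + 1) / (2 * n)

/-- `λ_min(D²u) / Δu ≥ -cₙ` at every point of `s`. -/
def DynamicSemiconvexOn {n : ℕ} (u : EuclideanSpace ℝ (Fin n) → ℝ)
    (s : Set (EuclideanSpace ℝ (Fin n))) : Prop :=
  ∀ x ∈ s, -cConst n ≤ lambdaMin (hessian u x) / Laplacian.laplacian u x

/-- `u` is semi-convex on `s` with constant `A`: the function `u + A|x|²` is convex there. -/
def SemiconvexOnWith {n : ℕ} (A : ℝ) (u : EuclideanSpace ℝ (Fin n) → ℝ)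
    (s : Set (EuclideanSpace ℝ (Fin n))) : Prop :=
  ConvexOn ℝ s fun x => u x + A * ‖x‖ ^ 2

/-- `‖u‖_{C¹(s)} ≤ M`: both `|u|` and `|∇u|` are at most `M` on `s`. -/
def C1Bound {n : ℕ} (u : EuclideanSpace ℝ (Fin n) → ℝ)
    (s : Set (EuclideanSpace ℝ (Fin n))) (M : ℝ) : Prop :=
  ∀ x ∈ s, |u x| ≤ M ∧ ‖fderiv ℝ u x‖ ≤ M

/-- `‖ψ‖_{C^{1,1}(S)} ≤ K`: on `S` the function `ψ` is differentiable, `|ψ|` and `|Dψ|` are at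
most `K`, and `Dψ` is Lipschitz with constant `K`. -/
def C11Bound {n : ℕ} (ψ : EuclideanSpace ℝ (Fin n) × ℝ → ℝ)
    (S : Set (EuclideanSpace ℝ (Fin n) × ℝ)) (K : ℝ) : Prop :=
  (∀ z ∈ S, DifferentiableAt ℝ ψ z ∧ |ψ z| ≤ K ∧ ‖fderiv ℝ ψ z‖ ≤ K) ∧
    ∀ z ∈ S, ∀ w ∈ S, ‖fderiv ℝ ψ z - fderiv ℝ ψ w‖ ≤ K * ‖z - w‖

/-- The data to which the estimate applies. The function `ψ` is positive on `B₄ × ℝ`, `u` is a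
`2`-convex solution on `B₄`, and `‖u‖_{C¹(B₃)} ≤ M`, `‖ψ‖_{C^{1,1}} ≤ K`, `‖1/ψ‖_{L^∞} ≤ L`. The
last two norms are only over `B₃ × [-M, M]`, which contains the points `(x, u(x))`, `x ∈ B₃`; so
all three norms are finite for suitable `M`, `K`, `L` as soon as `u ∈ C⁴(B₄)` and
`ψ > 0` is locally `C^{1,1}`. -/
structure IsAdmissible {n : ℕ} (M K L : ℝ) (ψ : EuclideanSpace ℝ (Fin n) × ℝ → ℝ)
    (u : EuclideanSpace ℝ (Fin n) → ℝ) : Prop where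
  psi_pos : ∀ x ∈ ball (0 : EuclideanSpace ℝ (Fin n)) 4, ∀ t : ℝ, 0 < ψ (x, t)
  solution : IsTwoConvexSolutionOn ψ u (ball 0 4)
  u_bound : C1Bound u (ball 0 3) M
  psi_bound : C11Bound ψ (ball 0 3 ×ˢ Icc (-M) M) K
  inv_psi_bound : ∀ z ∈ ball (0 : EuclideanSpace ℝ (Fin n)) 3 ×ˢ Icc (-M) M, 1 / ψ z ≤ L

/-- `sup_{B₂} Δu ≤ C (1 + sup_{B₁} Δu)`, with both suprema finite. -/
def DoublingInequality {n : ℕ} (u : EuclideanSpace ℝ (Fin n) → ℝ) (C : ℝ) : Prop :=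
  BddAbove (Laplacian.laplacian u '' ball 0 2) ∧
    sSup (Laplacian.laplacian u '' ball 0 2)
      ≤ C * (1 + sSup (Laplacian.laplacian u '' ball 0 1))

end HessianQuotient

end

/-!
The proof is a maximum principle argument for the linearized operator `F^{ij} ∂ᵢ∂ⱼ` of `σ₂/σ₁`,
whose eigenvalues at a point with Hessian eigenvalues `λᵢ` are `fᵢ = 1 - ψ/Δu - λᵢ/Δu`. It is
uniformly elliptic except in the direction of the largest eigenvalue `λⱼ`, and there `fⱼ λⱼ²` is
still bounded below.

The first ingredient is a Jacobi inequality for `b = log Δu` (`jacobi_inequality`). Differentiating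
the equation twice expresses `F^{ij} bᵢⱼ` through the third derivatives of `u`; these split into one
quadratic form for each eigendirection, constrained by the once differentiated equation, and each
form is minimized with a Lagrange multiplier (`quadratic_lower_bound`, `cubic_form_lower_bound`).
The result is `F^{ij} bᵢⱼ ≥ ε F^{ij} bᵢ bⱼ - C` for large `Δu`, where `ε > 0` is a constant if
`λ_min ≥ -(cₙ/2) Δu`, and `ε = -C/Δu` if only `λ_min ≥ -cₙ Δu`.

The second ingredient is the test function `P = log Δu - R² (N - a (x · ∇u - u) - B |∇u|²/2)`,
`R = 9/(9 - |x|²)`, on the ball of radius `3`. It attains its maximum at an interior point `x₀`.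
Suppose that `|x₀| ≥ 1` and `Δu(x₀)` is large compared with `R⁴`. If some eigenvalue is below
`-(cₙ/2) Δu`, then `F^{ij} uᵢₖ uⱼₖ`, which `|∇u|²` contributes with the factor `B`, is of order
`(Δu)²` and dominates (`le_of_very_negative_eigenvalue`). Otherwise the gradient term of the Jacobi
inequality dominates: the critical point equation expresses `∇b` through the gradients of the other
terms, and either some direction of uniform ellipticity sees the gradient of the cutoff, or `x₀` is
nearly aligned with the degenerate direction and `x · ∇u - u` contributes `a² R⁴ fⱼ λⱼ²`
(`le_of_gradient_control`). So either `|x₀| < 1` or `Δu(x₀) ≤ Λ R⁴`, and both bound `P` from above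
by `log (1 + sup_{B₁} Δu) + C`. The coefficient of `log Δu` in `P` being constant, the resulting
inequality is linear in `sup_{B₁} Δu`.

Semi-convexity implies `λ_min ≥ -cₙ Δu` wherever `Δu` is large, which is all that is used.
-/

open scoped Topology

namespace HessianQuotient

/-! ### Algebra of the cubic form of third derivatives -/

/-- Lower bound for the part of the cubic form of third derivatives that belongs to one
eigendirection `m`. In the application `μᵢ = λᵢ / Δu`, `aᵢ = ∂ᵢ∂ᵢ∂ₘu`, `v = ∂ₘΔu`, `γ = ψ / Δu`, and
`hμa` is the equation differentiated once in the direction `m`. The free parameter `κ` is a Lagrange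
multiplier for that constraint; the proof is the completion of squares at the minimizer
`aᵢ = v (r + κ μᵢ / 3)`, `i ≠ m`. -/
theorem quadratic_lower_bound {n : ℕ} (m : Fin n) (a μ : Fin n → ℝ) (v γ g' κ : ℝ)
    (hμ : ∑ i, μ i = 1) (hμ2 : ∑ i, μ i ^ 2 = 1 - 2 * γ) (ha : ∑ i, a i = v)
    (hμa : ∑ i, μ i * a i = (1 - γ) * v - g') :
    (2 * κ * (1 - γ - μ m) - 2 * κ ^ 2 * (1 - γ - μ m) / 3
        - ((n - 1) * (1 - κ * μ m) ^ 2 + 2 * κ * (1 - κ * μ m) * (1 - μ m)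
            - κ ^ 2 * (1 - μ m) ^ 2 * (n + 3) / 3) / (n + 2)) * v ^ 2
        - 2 * (κ - 1) * v * g'
      ≤ 3 * ∑ i, a i ^ 2 - 2 * a m ^ 2 - v ^ 2 + 2 * v * g' := by
  have hn : (n : ℝ) + 2 ≠ 0 := by positivity
  obtain ⟨r, hr⟩ : ∃ r : ℝ, r = (3 * (1 - κ * μ m) - κ * (1 - μ m)) / (3 * (n + 2)) := ⟨_, rfl⟩
  have hsum : ∑ i, (a i - v * (r + κ / 3 * μ i)) ^ 2 = ∑ i, a i ^ 2
      - 2 * v * (r * v + κ / 3 * ((1 - γ) * v - g'))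
      + v ^ 2 * (n * r ^ 2 + 2 * r * (κ / 3) + (κ / 3) ^ 2 * (1 - 2 * γ)) := by
    have e : ∀ i, (a i - v * (r + κ / 3 * μ i)) ^ 2 = a i ^ 2 - 2 * v * r * a i
        - 2 * v * (κ / 3) * (μ i * a i) + v ^ 2 * r ^ 2 + v ^ 2 * 2 * r * (κ / 3) * μ i
        + v ^ 2 * (κ / 3) ^ 2 * μ i ^ 2 := fun i => by ring
    simp only [e, Finset.sum_add_distrib, Finset.sum_sub_distrib, ← Finset.mul_sum, hμ, hμ2, ha,
      hμa, Finset.sum_const, Finset.card_univ, Fintype.card_fin, nsmul_eq_mul]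
    ring
  have h1 : (a m - v * (r + κ / 3 * μ m)) ^ 2 ≤ ∑ i, (a i - v * (r + κ / 3 * μ i)) ^ 2 :=
    Finset.single_le_sum (f := fun i => (a i - v * (r + κ / 3 * μ i)) ^ 2)
      (fun i _ => sq_nonneg _) (Finset.mem_univ m)
  have h2 := sq_nonneg (v - a m - v * ((n - 1) * r + κ / 3 * (1 - μ m)))
  rw [hsum] at h1
  rw [← sub_nonneg]
  have h3 := add_nonneg (mul_nonneg (by norm_num : (0 : ℝ) ≤ 3) (sub_nonneg.2 h1)) h2
  refine h3.trans_eq ?_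
  rw [hr]
  field_simp
  ring

/-- Choice of the multiplier `κ` in `quadratic_lower_bound` for an eigendirection that carries most
of the trace. Here `p = n - 1`, `s = 1 - μₘ` and `f` is the coefficient of the linearized operator,
for which only `s² ≤ 2 f` is available; `κ` is chosen so that the terms in `s²` have a sign. -/
theorem coeff_of_small {p s f : ℝ} (hp : 1 ≤ p) (hs : 0 < s) (hs' : s ≤ p / (2 * (p + 1)))
    (hf : s ^ 2 ≤ 2 * f) :
    ∃ κ, 1 ≤ κ ∧ κ - 1 ≤ 4 * s ∧ 4 / 3 * f ≤ 2 * κ * f - 2 * κ ^ 2 * f / 3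
      - (p * (1 - κ * (1 - s)) ^ 2 + 2 * κ * (1 - κ * (1 - s)) * s
        - κ ^ 2 * s ^ 2 * (p + 4) / 3) / (p + 3) := by
  have hp0 : 0 < p := by linarith
  have hle : s * (p + 1) / p ≤ 1 / 2 := by
    rw [le_div_iff₀ (by positivity)] at hs'
    rw [div_le_div_iff₀ hp0 (by norm_num)]; linarith
  have hpos : 0 < 1 - s * (p + 1) / p := by linarith
  have hκ : (1 - s * (p + 1) / p)⁻¹ * (1 - s * (p + 1) / p) = 1 := inv_mul_cancel₀ hpos.ne'
  generalize hk : (1 - s * (p + 1) / p)⁻¹ = κ at hκ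
  have hκ0 : 0 < κ := hk ▸ inv_pos.2 hpos
  have hx : 0 < s * (p + 1) / p := by positivity
  have hκ2 : κ ≤ 2 := by nlinarith
  have hκ1 : 1 ≤ κ := by nlinarith
  have hx2 : s * (p + 1) / p ≤ 2 * s := by
    rw [div_le_iff₀ hp0]; nlinarith
  refine ⟨κ, hκ1, by nlinarith, ?_⟩
  have hh : 1 - κ * (1 - s) = - (κ * s / p) := by
    have : κ * (1 - s * (p + 1) / p) = κ * (1 - s) - κ * s / p := by field_simp; ring
    linarith
  rw [hh]
  have h1 : (p * (-(κ * s / p)) ^ 2 + 2 * κ * -(κ * s / p) * s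
        - κ ^ 2 * s ^ 2 * (p + 4) / 3) / (p + 3)
      = - (κ ^ 2 * s ^ 2 * (1 / p + (p + 4) / 3) / (p + 3)) := by
    field_simp; ring
  have h2 : 0 ≤ κ ^ 2 * s ^ 2 * (1 / p + (p + 4) / 3) / (p + 3) := by positivity
  have hf0 : 0 ≤ f := by nlinarith [sq_nonneg s]
  rw [h1]
  nlinarith [mul_nonneg hf0 (mul_nonneg (sub_nonneg.2 hκ1) (sub_nonneg.2 hκ2))]

/-- Choice of the multiplier `κ` in `quadratic_lower_bound` away from the degenerate direction,
where the coefficient of the linearized operator is `s - γ` with `γ` small compared with `s`. For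
`γ = 0` the expression is a quadratic polynomial in `κ`, and `κ = (2 s + p) / q` is its maximizer.
-/
theorem coeff_of_large {p s γ : ℝ} (hp : 1 ≤ p) (hs : 0 < s) (hs' : s ≤ 2) (hγ : 0 ≤ γ)
    (hj : 0 ≤ p + 2 * (p + 2) * s - 2 * (p + 1) * s ^ 2) :
    ∃ κ, 0 ≤ κ ∧ κ ≤ 15 ∧ s + s * (p + 2 * (p + 2) * s - 2 * (p + 1) * s ^ 2) / (21 * p) - 30 * γ
      ≤ 2 * κ * (s - γ) - 2 * κ ^ 2 * (s - γ) / 3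
      - (p * (1 - κ * (1 - s)) ^ 2 + 2 * κ * (1 - κ * (1 - s)) * s
        - κ ^ 2 * s ^ 2 * (p + 4) / 3) / (p + 3) := by
  have hp0 : 0 < p := by linarith
  -- `-q / (p + 3)` is the leading coefficient in `κ` of the expression at `γ = 0`
  obtain ⟨q, hq⟩ : ∃ q, q = p - 4 * p * s / 3 + 2 * (p + 1) * s ^ 2 / 3 := ⟨_, rfl⟩
  have hq1 : p / 3 ≤ q := by
    rw [hq]; nlinarith [sq_nonneg (s - 1), sq_nonneg s]
  have hq0 : 0 < q := by linarith
  have hq2 : q ≤ 7 * p := by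
    rw [hq]; nlinarith [mul_pos hp0 hs, mul_nonneg hs.le (sub_nonneg.2 hs')]
  have hκ : (2 * s + p) / q * q = 2 * s + p := div_mul_cancel₀ _ hq0.ne'
  have hκ0 : 0 ≤ (2 * s + p) / q := by positivity
  have hκ15 : (2 * s + p) / q ≤ 15 := by
    rw [div_le_iff₀ hq0]; linarith
  have hE : 2 * ((2 * s + p) / q) * (s - γ) - 2 * ((2 * s + p) / q) ^ 2 * (s - γ) / 3
      - (p * (1 - (2 * s + p) / q * (1 - s)) ^ 2
        + 2 * ((2 * s + p) / q) * (1 - (2 * s + p) / q * (1 - s)) * s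
        - ((2 * s + p) / q) ^ 2 * s ^ 2 * (p + 4) / 3) / (p + 3)
      = s + s * (p + 2 * (p + 2) * s - 2 * (p + 1) * s ^ 2) / (3 * q)
        - γ * (2 * ((2 * s + p) / q) - 2 * ((2 * s + p) / q) ^ 2 / 3) := by
    generalize hk : (2 * s + p) / q = κ at *
    have hp3 : p + 3 ≠ 0 := by positivity
    have h1 : s * (p + 2 * (p + 2) * s - 2 * (p + 1) * s ^ 2) / (3 * q)
        = ((2 * s + p) ^ 2 / q - p) / (p + 3) - s := by
      field_simp
      rw [hq]; ring
    have h2 : (2 * s + p) ^ 2 / q = κ ^ 2 * q := by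
      rw [← hκ]; field_simp
    have h3 : κ ^ 2 * q = 2 * κ * (2 * s + p) - κ ^ 2 * q := by rw [← hκ]; ring
    rw [h1, h2, h3, hq]
    field_simp
    ring
  refine ⟨_, hκ0, hκ15, ?_⟩
  rw [hE]
  have h4 : s * (p + 2 * (p + 2) * s - 2 * (p + 1) * s ^ 2) / (21 * p)
      ≤ s * (p + 2 * (p + 2) * s - 2 * (p + 1) * s ^ 2) / (3 * q) := by
    apply div_le_div_of_nonneg_left (by positivity) (by positivity) (by linarith)
  nlinarith [mul_nonneg hγ (sub_nonneg.2 hκ15), mul_nonneg hγ (sq_nonneg ((2 * s + p) / q))]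

theorem cConst_pos {n : ℕ} (hn : 2 ≤ n) : 0 < cConst n := by
  have hn' : (2 : ℝ) ≤ n := by exact_mod_cast hn
  have : (n : ℝ) - 1 < √(3 * (n : ℝ) ^ 2 + 1) := Real.lt_sqrt_of_sq_lt (by nlinarith)
  unfold cConst
  exact div_pos (by linarith) (by positivity)

theorem cConst_le_one {n : ℕ} (hn : 2 ≤ n) : cConst n ≤ 1 := by
  have hn' : (2 : ℝ) ≤ n := by exact_mod_cast hn
  have : √(3 * (n : ℝ) ^ 2 + 1) ≤ 2 * n := by
    rw [Real.sqrt_le_left (by positivity)]; nlinarith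
  unfold cConst
  rw [div_le_one (by positivity)]
  linarith

/-- The constant `cₙ` is sharp for the method: `1 + cₙ` is the positive zero of the quadratic
polynomial that measures the gain in `coeff_of_large`. -/
theorem cConst_root {n : ℕ} (hn : 2 ≤ n) :
    ((n : ℝ) - 1) + 2 * (n + 1) * (1 + cConst n) - 2 * n * (1 + cConst n) ^ 2 = 0 := by
  have hn' : (2 : ℝ) ≤ n := by exact_mod_cast hn
  have h : √(3 * (n : ℝ) ^ 2 + 1) ^ 2 = 3 * (n : ℝ) ^ 2 + 1 := Real.sq_sqrt (by positivity)
  have h2 : 1 + cConst n = (√(3 * (n : ℝ) ^ 2 + 1) + n + 1) / (2 * n) := by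
    unfold cConst; field_simp; ring
  rw [h2]
  generalize √(3 * (n : ℝ) ^ 2 + 1) = t at h
  field_simp
  linear_combination (-1) * h

set_option maxHeartbeats 2000000 in
/-- The contribution of the direction `m` to the Jacobi inequality. Down to `μₘ = -cₙ` the bound
degenerates, but only by the factor `1 - C / w`; for `μₘ ≥ -cₙ / 2` there is a definite gain `ε`. -/
theorem cubic_form_lower_bound {n : ℕ} (hn : 2 ≤ n) {K G : ℝ} (hK : 0 ≤ K) :
    ∃ ε : ℝ, 0 < ε ∧ ∃ C : ℝ, 0 ≤ C ∧ ∃ W : ℝ, 1 ≤ W ∧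
      ∀ (m : Fin n) (a μ : Fin n → ℝ) (v w g g' : ℝ), W ≤ w → 0 < g → g ≤ K → |g'| ≤ G →
        ∑ i, μ i = 1 → ∑ i, μ i ^ 2 = 1 - 2 * (g / w) → ∑ i, a i = v →
        ∑ i, μ i * a i = (1 - g / w) * v - g' →
        (-cConst n ≤ μ m → (1 - C / w) * ((1 - g / w - μ m) * v ^ 2) - C * w
          ≤ 3 * ∑ i, a i ^ 2 - 2 * a m ^ 2 - v ^ 2 + 2 * v * g') ∧
        (-(cConst n / 2) ≤ μ m → (1 + ε) * ((1 - g / w - μ m) * v ^ 2) - C * w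
          ≤ 3 * ∑ i, a i ^ 2 - 2 * a m ^ 2 - v ^ 2 + 2 * v * g') := by
  have hn' : (2 : ℝ) ≤ n := by exact_mod_cast hn
  have hc := cConst_pos hn
  have hc1 := cConst_le_one hn
  have hroot := cConst_root hn
  generalize cConst n = c at *
  obtain ⟨ε, hε⟩ : ∃ ε : ℝ, ε = c / (42 * (1 + c)) := ⟨_, rfl⟩
  have hε0 : 0 < ε := hε ▸ by positivity
  have hε1 : ε ≤ 1 / 42 := by
    rw [hε, div_le_div_iff₀ (by positivity) (by norm_num)]; linarith
  refine ⟨ε / 2, by positivity, 384 * G ^ 2 + 3600 * G ^ 2 / ε + 240 * K + 120 + 15 * G ^ 2,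
    by positivity, 1 + 480 * K / ε, by simp; positivity, ?_⟩
  intro m a μ v w g g' hw hg hgK hg' hμ hμ2 ha hμa
  have hKε : 0 ≤ 480 * K / ε := by positivity
  have hw1 : 1 ≤ w := by linarith
  have hw0 : 0 < w := by linarith
  have hγ : 0 < g / w := by positivity
  have hγε : 480 * (g / w) ≤ ε := by
    have : 480 * K / ε ≤ w := by linarith
    rw [div_le_iff₀ hε0] at this
    rw [mul_div_assoc', div_le_iff₀ hw0]; linarith
  have hγw : g / w ≤ K / w := by gcongr
  have hQ := quadratic_lower_bound m a μ v (g / w) g'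
  -- the sum of the `μ i ^ 2` over `i ≠ m` is `2 * (1 - γ - μ m) - (1 - μ m) ^ 2`
  have hsq : (1 - μ m) ^ 2 ≤ 2 * (1 - g / w - μ m) := by
    have : μ m ^ 2 ≤ ∑ i, μ i ^ 2 :=
      Finset.single_le_sum (f := fun i => μ i ^ 2) (fun i _ => sq_nonneg _) (Finset.mem_univ m)
    linarith
  have hG0 : 0 ≤ G := (abs_nonneg _).trans hg'
  have hG2 : g' ^ 2 ≤ G ^ 2 :=
    sq_le_sq' (by linarith [neg_abs_le g']) (by linarith [le_abs_self g'])
  generalize hγdef : g / w = γ at *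
  obtain ⟨s, hs⟩ : ∃ s, s = 1 - μ m := ⟨_, rfl⟩
  have hμs : μ m = 1 - s := by linarith
  obtain ⟨f, hf⟩ : ∃ f, f = 1 - γ - μ m := ⟨_, rfl⟩
  have hfs : f = s - γ := by linarith
  obtain ⟨p, hp⟩ : ∃ p : ℝ, p = n - 1 := ⟨_, rfl⟩
  have hnp : (n : ℝ) = p + 1 := by linarith
  generalize 3 * ∑ i, a i ^ 2 - 2 * a m ^ 2 - v ^ 2 + 2 * v * g' = Q at *
  rw [← hs, ← hf] at hsq
  rw [← hf]
  have hQ' : ∀ κ, (2 * κ * f - 2 * κ ^ 2 * f / 3 - (p * (1 - κ * (1 - s)) ^ 2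
        + 2 * κ * (1 - κ * (1 - s)) * s - κ ^ 2 * s ^ 2 * (p + 4) / 3) / (p + 3)) * v ^ 2
        - 2 * (κ - 1) * v * g' ≤ Q := by
    intro κ
    have := hQ κ hμ hμ2 ha hμa
    rw [← hf, ← hs, hμs, hnp] at this
    ring_nf at this ⊢
    exact this
  have hf0 : 0 ≤ f := by linarith [sq_nonneg s]
  have hs0 : 0 < s := by linarith
  have hp1 : 1 ≤ p := by linarith
  have hv2 := sq_nonneg v
  have hfv : 0 ≤ f * v ^ 2 := by positivity
  have hGε : 0 ≤ 3600 * G ^ 2 / ε := by positivity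
  have hGG : 0 ≤ G ^ 2 := sq_nonneg G
  clear hQ
  have hCw : ∀ C : ℝ, 0 ≤ C → C ≤ C * w := fun C hC => le_mul_of_one_le_right hC hw1
  -- a direction that carries most of the trace has a definite gain, with no condition on `μ m`
  by_cases hsmall : s ≤ p / (2 * (p + 1))
  · obtain ⟨κ, hκ1, hκs, hE⟩ := coeff_of_small hp1 hs0 hsmall hsq
    have h1 := hQ' κ
    have h2 : 2 * (κ - 1) * v * g' ≤ 1 / 12 * (f * v ^ 2) + 384 * G ^ 2 := by
      have : 2 * (κ - 1) * v * g' ≤ 1 / 384 * ((κ - 1) * v) ^ 2 + 384 * g' ^ 2 := by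
        linarith [sq_nonneg ((κ - 1) * v - 384 * g')]
      have h3 : ((κ - 1) * v) ^ 2 ≤ 32 * (f * v ^ 2) := by
        have : (κ - 1) ^ 2 ≤ 32 * f := by
          have := pow_le_pow_left₀ (sub_nonneg.2 hκ1) hκs 2
          linarith
        calc ((κ - 1) * v) ^ 2 = (κ - 1) ^ 2 * v ^ 2 := by ring
          _ ≤ 32 * f * v ^ 2 := by gcongr
          _ = _ := by ring
      linarith
    have h3 : 5 / 4 * (f * v ^ 2) - 384 * G ^ 2 ≤ Q := by
      have := mul_le_mul_of_nonneg_right hE hv2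
      linarith
    have h4 := hCw (384 * G ^ 2 + 3600 * G ^ 2 / ε + 240 * K + 120 + 15 * G ^ 2) (by positivity)
    constructor
    · intro _
      have : 0 ≤ (384 * G ^ 2 + 3600 * G ^ 2 / ε + 240 * K + 120 + 15 * G ^ 2) / w
          * (f * v ^ 2) := by
        positivity
      rw [sub_mul, one_mul]
      linarith
    · intro _
      have : ε / 2 * (f * v ^ 2) ≤ 1 / 4 * (f * v ^ 2) :=
        mul_le_mul_of_nonneg_right (by linarith) hfv
      rw [add_mul, one_mul]
      linarith
  · have hs4 : 1 / 4 < s := by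
      refine lt_of_le_of_lt ?_ (not_le.1 hsmall)
      rw [div_le_div_iff₀ (by norm_num) (by positivity)]; linarith
    -- `s = 1 + c` is the positive zero of this polynomial
    have hfac : p + 2 * (p + 2) * s - 2 * (p + 1) * s ^ 2
        = (1 + c - s) * (2 * (p + 1) * s + p / (1 + c)) := by
      rw [hnp] at hroot
      have hc0 : 1 + c ≠ 0 := by positivity
      field_simp
      linear_combination s * hroot
    have hlarge : s ≤ 1 + c → s * (1 + (1 + c - s) / (21 * (1 + c))) * v ^ 2 - 30 * γ * v ^ 2
        - 30 * |v| * G ≤ Q := by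
      intro hsc
      have hpc : 0 ≤ p / (1 + c) := by positivity
      have hj : (1 + c - s) * (p / (1 + c)) ≤ p + 2 * (p + 2) * s - 2 * (p + 1) * s ^ 2 := by
        rw [hfac]
        apply mul_le_mul_of_nonneg_left _ (by linarith)
        have : 0 ≤ 2 * (p + 1) * s := by positivity
        linarith
      have hj0 : 0 ≤ p + 2 * (p + 2) * s - 2 * (p + 1) * s ^ 2 :=
        le_trans (mul_nonneg (by linarith) hpc) hj
      obtain ⟨κ, hκ0, hκ1, hE⟩ := coeff_of_large (γ := γ) hp1 hs0 (by linarith) hγ.le hj0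
      have h1 := hQ' κ
      rw [hfs] at h1
      have h2 : s * ((1 + c - s) / (21 * (1 + c)))
          ≤ s * (p + 2 * (p + 2) * s - 2 * (p + 1) * s ^ 2) / (21 * p) := by
        rw [mul_div_assoc]
        apply mul_le_mul_of_nonneg_left _ hs0.le
        rw [le_div_iff₀ (by positivity)]
        refine le_trans (le_of_eq ?_) hj
        field_simp
      have h3 := mul_le_mul_of_nonneg_right (le_trans (by linarith :
        s + s * ((1 + c - s) / (21 * (1 + c))) - 30 * γ ≤ _) hE) hv2
      have h4 : 2 * (κ - 1) * v * g' ≤ 30 * |v| * G := by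
        calc 2 * (κ - 1) * v * g' ≤ |2 * (κ - 1) * v * g'| := le_abs_self _
          _ = 2 * |κ - 1| * |v| * |g'| := by rw [abs_mul, abs_mul, abs_mul, abs_two]
          _ ≤ 2 * 15 * |v| * G := by
            gcongr
            rw [abs_le]; constructor <;> linarith
          _ = _ := by ring
      linarith
    constructor
    -- at `μ m = -c` nothing is gained, and the error `30 * γ * v ^ 2` is of order `v ^ 2 / w`
    · intro hμm
      have h1 := hlarge (by linarith)
      have h2 : 30 * |v| * G ≤ 15 / w * v ^ 2 + 15 * G ^ 2 * w := by
        have : 0 ≤ 15 / w * (|v| - G * w) ^ 2 := by positivity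
        have h3 : 15 / w * (|v| - G * w) ^ 2 = 15 / w * v ^ 2 - 30 * |v| * G + 15 * G ^ 2 * w := by
          rw [← sq_abs v]; field_simp; ring
        linarith
      have h3 : 0 ≤ s * ((1 + c - s) / (21 * (1 + c))) * v ^ 2 := by
        have : 0 ≤ 1 + c - s := by linarith
        positivity
      have h4 : v ^ 2 ≤ 8 * (f * v ^ 2) := by
        have : 1 ≤ 8 * f := by linarith
        calc v ^ 2 ≤ 8 * f * v ^ 2 := le_mul_of_one_le_left hv2 this
          _ = _ := by ring
      have h5 : (30 * K + 15) / w * v ^ 2 ≤ (240 * K + 120) / w * (f * v ^ 2) := by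
        calc (30 * K + 15) / w * v ^ 2 ≤ (30 * K + 15) / w * (8 * (f * v ^ 2)) := by gcongr
          _ = _ := by ring
      have h6 : 30 * γ * v ^ 2 ≤ 30 * K / w * v ^ 2 := by
        rw [mul_div_assoc]; gcongr
      have h7 : (30 * K + 15) / w * v ^ 2 = 30 * K / w * v ^ 2 + 15 / w * v ^ 2 := by ring
      have h8 : f * v ^ 2 ≤ s * v ^ 2 := by gcongr; linarith
      have h9 : 0 ≤ (384 * G ^ 2 + 3600 * G ^ 2 / ε + 15 * G ^ 2) / w * (f * v ^ 2) := by positivity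
      have h10 : (384 * G ^ 2 + 3600 * G ^ 2 / ε + 240 * K + 120 + 15 * G ^ 2) / w * (f * v ^ 2)
          = (384 * G ^ 2 + 3600 * G ^ 2 / ε + 15 * G ^ 2) / w * (f * v ^ 2)
            + (240 * K + 120) / w * (f * v ^ 2) := by ring
      have h11 : 0 ≤ (384 * G ^ 2 + 3600 * G ^ 2 / ε + 240 * K + 120) * w := by positivity
      have h12 : s * v ^ 2 = f * v ^ 2 + γ * v ^ 2 := by rw [hfs]; ring
      rw [sub_mul, one_mul, h10]
      rw [mul_add, add_mul, mul_one] at h1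
      linarith
    · intro hμm
      have h1 := hlarge (by linarith)
      have h2 : 30 * |v| * G ≤ ε / 16 * v ^ 2 + 3600 * G ^ 2 / ε := by
        have : 0 ≤ 1 / (16 * ε) * (ε * |v| - 240 * G) ^ 2 := by positivity
        have h3 : 1 / (16 * ε) * (ε * |v| - 240 * G) ^ 2
            = ε / 16 * v ^ 2 - 30 * |v| * G + 3600 * G ^ 2 / ε := by
          rw [← sq_abs v]; field_simp; ring
        linarith
      have h3 : ε ≤ (1 + c - s) / (21 * (1 + c)) := by
        rw [hε, div_le_div_iff₀ (by positivity) (by positivity)]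
        linarith [mul_nonneg hc.le hc.le, mul_nonneg hc.le (by linarith : 0 ≤ 1 + c / 2 - s)]
      have h4 : s * ε * v ^ 2 ≤ s * ((1 + c - s) / (21 * (1 + c))) * v ^ 2 := by gcongr
      have h5 : 30 * γ * v ^ 2 ≤ ε / 16 * v ^ 2 := by gcongr; linarith
      have h6 : ε / 8 * v ^ 2 ≤ s * ε / 2 * v ^ 2 := by
        apply mul_le_mul_of_nonneg_right _ hv2
        linarith [mul_le_mul_of_nonneg_right hs4.le hε0.le]
      have h7 : f * v ^ 2 ≤ s * v ^ 2 := by gcongr; linarith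
      have h8 : ε / 2 * (f * v ^ 2) ≤ ε / 2 * (s * v ^ 2) := by gcongr
      have h9 := hCw (384 * G ^ 2 + 3600 * G ^ 2 / ε + 240 * K + 120 + 15 * G ^ 2) (by positivity)
      have h10 : 0 ≤ 384 * G ^ 2 + 240 * K + 120 + 15 * G ^ 2 := by positivity
      rw [mul_add, add_mul, mul_one] at h1
      rw [add_mul, one_mul]
      linarith

/-! ### Coefficients of the linearized operator -/

section LinearizedCoefficients

variable {n : ℕ} {lam : Fin n → ℝ} {w g : ℝ}

theorem two_mul_le_of_sum_sq (hw : 0 < w) (h2 : ∑ i, lam i ^ 2 = w ^ 2 - 2 * g * w) :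
    2 * g ≤ w := by
  have : 0 ≤ ∑ i, lam i ^ 2 := Finset.sum_nonneg fun i _ => sq_nonneg _
  rw [h2] at this
  by_contra h
  nlinarith

theorem sq_le_of_sum_sq (h2 : ∑ i, lam i ^ 2 = w ^ 2 - 2 * g * w) (i : Fin n) :
    lam i ^ 2 ≤ w ^ 2 - 2 * g * w :=
  h2 ▸ Finset.single_le_sum (f := fun j => lam j ^ 2) (fun _ _ => sq_nonneg _) (Finset.mem_univ i)

theorem abs_le_of_sum_sq (hw : 0 < w) (hg : 0 < g) (h2 : ∑ i, lam i ^ 2 = w ^ 2 - 2 * g * w)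
    (i : Fin n) : |lam i| ≤ w := by
  apply abs_le_of_sq_le_sq _ hw.le
  have := sq_le_of_sum_sq h2 i
  have := mul_pos hg hw
  linarith

/-- The numbers `1 - g / w - λᵢ / w` are the eigenvalues of the linearized operator
`∂(σ₂/σ₁)/∂uᵢⱼ` when `σ₁ = w` and `σ₂/σ₁ = g`. -/
theorem mul_coeff_eq (hw : 0 < w) (i : Fin n) :
    (1 - g / w - lam i / w) * w = w - g - lam i := by
  field_simp

theorem coeff_pos (hw : 0 < w) (hg : 0 < g) (h2 : ∑ i, lam i ^ 2 = w ^ 2 - 2 * g * w)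
    (i : Fin n) : 0 < 1 - g / w - lam i / w := by
  have h1 := sq_le_of_sum_sq h2 i
  have h3 := two_mul_le_of_sum_sq hw h2
  have h4 : lam i < w - g := lt_of_pow_lt_pow_left₀ 2 (by linarith) (by
    have := pow_pos hg 2
    linarith)
  refine pos_of_mul_pos_left (b := w) ?_ hw.le
  rw [mul_coeff_eq hw]
  linarith

theorem coeff_le_two (hw : 0 < w) (hg : 0 < g) (h2 : ∑ i, lam i ^ 2 = w ^ 2 - 2 * g * w)
    (i : Fin n) : 1 - g / w - lam i / w ≤ 2 := by
  have h1 := neg_le_of_abs_le (abs_le_of_sum_sq hw hg h2 i)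
  refine le_of_mul_le_mul_right ?_ hw
  rw [mul_coeff_eq hw]
  linarith

theorem half_le_coeff (hw : 0 < w) (h2 : ∑ i, lam i ^ 2 = w ^ 2 - 2 * g * w)
    {i : Fin n} (hi : lam i ≤ 0) : 1 / 2 ≤ 1 - g / w - lam i / w := by
  have h3 := two_mul_le_of_sum_sq hw h2
  refine le_of_mul_le_mul_right ?_ hw
  rw [mul_coeff_eq hw]
  linarith

/-- The linearized operator is uniformly elliptic away from the direction of the largest eigenvalue.
-/
theorem eighth_le_coeff (hw : 0 < w) (hg : 0 < g) (h2 : ∑ i, lam i ^ 2 = w ^ 2 - 2 * g * w)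
    {i j : Fin n} (hij : i ≠ j) (hle : lam i ≤ lam j) : 1 / 8 ≤ 1 - g / w - lam i / w := by
  have h3 := two_mul_le_of_sum_sq hw h2
  have h4 : lam i ≤ 3 / 4 * (w - g) := by
    rcases le_or_gt (lam i) 0 with h | h
    · linarith
    · have h5 : lam i ^ 2 + lam j ^ 2 ≤ ∑ k, lam k ^ 2 := by
        rw [← Finset.sum_pair hij (f := fun k => lam k ^ 2)]
        exact Finset.sum_le_sum_of_subset_of_nonneg (Finset.subset_univ _)
          fun k _ _ => sq_nonneg _
      have h6 : lam i ^ 2 ≤ lam j ^ 2 := pow_le_pow_left₀ h.le hle 2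
      refine le_of_sq_le_sq ?_ (by linarith)
      have h7 : 0 ≤ (w - g) ^ 2 := sq_nonneg _
      have h8 := pow_pos hg 2
      linarith
  refine le_of_mul_le_mul_right ?_ hw
  rw [mul_coeff_eq hw]
  linarith

theorem div_le_of_max (h1 : ∑ i, lam i = w) {j : Fin n} (hj : ∀ i, lam i ≤ lam j) :
    w / n ≤ lam j := by
  have hn : (0 : ℝ) < n := by exact_mod_cast Fin.pos j
  rw [div_le_iff₀ hn, ← h1]
  calc ∑ i, lam i ≤ ∑ _i : Fin n, lam j := Finset.sum_le_sum fun i _ => hj i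
    _ = lam j * n := by simp [mul_comm]

/-- In the direction of the largest eigenvalue the linearized operator may degenerate like `w⁻²`,
but no faster: its coefficient times the square of the eigenvalue stays bounded below. -/
theorem coeff_mul_sq_ge (hw : 0 < w) (hg : 0 < g) (h1 : ∑ i, lam i = w)
    (h2 : ∑ i, lam i ^ 2 = w ^ 2 - 2 * g * w) {j : Fin n} (hj : ∀ i, lam i ≤ lam j) :
    g ^ 2 / (2 * n ^ 2) ≤ (1 - g / w - lam j / w) * lam j ^ 2 := by
  have hn : (0 : ℝ) < n := by exact_mod_cast Fin.pos j
  have h3 := div_le_of_max h1 hj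
  have h4 := sq_le_of_sum_sq h2 j
  have h5 := coeff_pos hw hg h2 j
  have h6 := mul_coeff_eq (lam := lam) (g := g) hw j
  have h7 := le_of_abs_le (abs_le_of_sum_sq hw hg h2 j)
  generalize 1 - g / w - lam j / w = f at *
  have h8 : g ^ 2 ≤ 2 * w ^ 2 * f := by
    have h9 : f * w * (w - g + lam j) ≤ f * w * (2 * w) :=
      mul_le_mul_of_nonneg_left (by linarith) (by positivity)
    have h10 : g ^ 2 ≤ f * w * (w - g + lam j) := by rw [h6]; linarith
    linarith
  have h9 : (w / n) ^ 2 ≤ lam j ^ 2 := pow_le_pow_left₀ (by positivity) h3 2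
  calc g ^ 2 / (2 * n ^ 2) ≤ 2 * w ^ 2 * f / (2 * n ^ 2) := by gcongr
    _ = f * (w / n) ^ 2 := by field_simp
    _ ≤ f * lam j ^ 2 := by gcongr

end LinearizedCoefficients

/-! ### The inequality at a maximum point -/

section MaximumPoint

variable {n : ℕ} {lam x d b : Fin n → ℝ} {w g a B N M E R J G₁ G₂ C C₂ S c ε L : ℝ}

theorem abs_add_le_four_mul {ξ δ : ℝ} (ha : 0 < a) (hB : 0 < B) (hBM : B * M ≤ a) (hξ : |ξ| ≤ 3)
    (hδ : |δ| ≤ M) : |a * ξ + B * δ| ≤ 4 * a := by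
  calc |a * ξ + B * δ| ≤ |a * ξ| + |B * δ| := abs_add_le _ _
    _ = a * |ξ| + B * |δ| := by rw [abs_mul, abs_mul, abs_of_pos ha, abs_of_pos hB]
    _ ≤ a * 3 + B * M := by gcongr
    _ ≤ _ := by linarith

/-- The second-order condition at a maximum of the test function, with the lower-order terms
absorbed: `S` is the gradient term of the Jacobi inequality, and the loss is at most a multiple of
`N R⁴` that does not involve `a` and `B`. -/
theorem maximum_inequality (hn : 1 ≤ n) (hw : 0 < w) (hg : 0 < g)
    (h2 : ∑ i, lam i ^ 2 = w ^ 2 - 2 * g * w) (hR : 1 ≤ R) (hd : ∀ i, |d i| ≤ M)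
    (hx : ∀ i, |x i| ≤ 3) (hE0 : 0 ≤ E) (hE : E ≤ 2 * N) (ha : 0 < a) (hB : 0 < B)
    (hBM : B * M ≤ a) (haB : a ^ 2 ≤ B * N) (hC₂ : (a + B) * C₂ ≤ N) (hC : C ≤ N)
    (hG₁ : |G₁| ≤ C₂) (hG₂ : |G₂| ≤ C₂) (hJ : S - C ≤ J)
    (hmax : J - E * ∑ i, (1 - g / w - lam i / w) * (4 / 9 * R ^ 3 + 8 / 27 * R ^ 4 * x i ^ 2)
      + 8 / 9 * R ^ 3 * ∑ i, (1 - g / w - lam i / w) * (x i * (a * x i + B * d i) * lam i)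
      + R ^ 2 * (a * G₁ + B * (∑ i, (1 - g / w - lam i / w) * lam i ^ 2 + G₂)) ≤ 0) :
    S + B / 2 * R ^ 2 * ∑ i, (1 - g / w - lam i / w) * lam i ^ 2 ≤ 140 * n * N * R ^ 4 := by
  have hf := coeff_pos hw hg h2
  have hf2 := coeff_le_two hw hg h2
  generalize hfd : (fun i => 1 - g / w - lam i / w) = f at *
  have hfd' : ∀ i, 1 - g / w - lam i / w = f i := fun i => congrFun hfd i
  simp only [hfd'] at *
  clear hfd hfd'
  have hn' : (1 : ℝ) ≤ n := by exact_mod_cast hn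
  have hR0 : 0 < R := by linarith
  have hN : 0 ≤ N := by linarith
  have hR3 : R ^ 3 ≤ R ^ 4 := pow_le_pow_right₀ hR (by norm_num)
  have hR2 : R ^ 2 ≤ R ^ 4 := pow_le_pow_right₀ hR (by norm_num)
  have hR4 : 1 ≤ R ^ 4 := one_le_pow₀ hR
  have e1 : E * ∑ i, f i * (4 / 9 * R ^ 3 + 8 / 27 * R ^ 4 * x i ^ 2) ≤ 13 * n * N * R ^ 4 := by
    have : ∀ i, f i * (4 / 9 * R ^ 3 + 8 / 27 * R ^ 4 * x i ^ 2) ≤ 2 * (28 / 9 * R ^ 4) := by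
      intro i
      have h9 : x i ^ 2 ≤ 9 := by
        rw [← sq_abs]; calc |x i| ^ 2 ≤ 3 ^ 2 := by gcongr; exact hx i
          _ = 9 := by norm_num
      have : 8 / 27 * R ^ 4 * x i ^ 2 ≤ 8 / 27 * R ^ 4 * 9 := by gcongr
      apply mul_le_mul (hf2 i) (by linarith) (by positivity) (by norm_num)
    calc E * ∑ i, f i * (4 / 9 * R ^ 3 + 8 / 27 * R ^ 4 * x i ^ 2)
        ≤ (2 * N) * ∑ _i : Fin n, 2 * (28 / 9 * R ^ 4) := by
          apply mul_le_mul hE (Finset.sum_le_sum fun i _ => this i) _ (by linarith)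
          exact Finset.sum_nonneg fun i _ => mul_nonneg (hf i).le (by positivity)
      _ = (112 / 9) * n * N * R ^ 4 := by simp; ring
      _ ≤ 13 * n * N * R ^ 4 := by gcongr; norm_num
  -- the mixed terms are absorbed in half of the term `B * R ^ 2 * ∑ i, f i * lam i ^ 2`
  have e2 : -(8 / 9 * R ^ 3 * ∑ i, f i * (x i * (a * x i + B * d i) * lam i))
      ≤ B / 2 * R ^ 2 * ∑ i, f i * lam i ^ 2 + 121 * n * N * R ^ 4 := by
    have : ∀ i, -(8 / 9 * R ^ 3 * (f i * (x i * (a * x i + B * d i) * lam i)))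
        ≤ B / 2 * R ^ 2 * (f i * lam i ^ 2) + 121 * N * R ^ 4 := by
      intro i
      have h1 := abs_add_le_four_mul ha hB hBM (hx i) (hd i)
      have h3 : |x i * (a * x i + B * d i) * lam i| ≤ 12 * a * |lam i| := by
        rw [abs_mul, abs_mul]
        calc |x i| * |a * x i + B * d i| * |lam i| ≤ 3 * (4 * a) * |lam i| := by gcongr; exact hx i
          _ = _ := by ring
      have h4 : -(8 / 9 * R ^ 3 * (x i * (a * x i + B * d i) * lam i))
          ≤ 11 * a * R ^ 3 * |lam i| := by
        calc -(8 / 9 * R ^ 3 * (x i * (a * x i + B * d i) * lam i))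
            = 8 / 9 * R ^ 3 * -(x i * (a * x i + B * d i) * lam i) := by ring
          _ ≤ 8 / 9 * R ^ 3 * (12 * a * |lam i|) := by
            gcongr; exact (neg_le_abs _).trans h3
          _ ≤ 11 * a * R ^ 3 * |lam i| := by
            have : 0 ≤ a * R ^ 3 * |lam i| := by positivity
            linarith
      have h5 : 11 * a * R ^ 3 * |lam i| ≤ B / 2 * R ^ 2 * lam i ^ 2 + 121 / 2 * N * R ^ 4 := by
        have h6 : 0 ≤ R ^ 2 / (2 * B) * (B * |lam i| - 11 * a * R) ^ 2 := by positivity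
        have h7 : R ^ 2 / (2 * B) * (B * |lam i| - 11 * a * R) ^ 2
            = B / 2 * R ^ 2 * lam i ^ 2 - 11 * a * R ^ 3 * |lam i|
              + 121 / 2 * (a ^ 2 / B) * R ^ 4 := by
          rw [← sq_abs (lam i)]; field_simp; ring
        have h8 : 121 / 2 * (a ^ 2 / B) * R ^ 4 ≤ 121 / 2 * N * R ^ 4 := by
          gcongr
          rw [div_le_iff₀ hB]; linarith
        linarith
      calc -(8 / 9 * R ^ 3 * (f i * (x i * (a * x i + B * d i) * lam i)))
          = f i * -(8 / 9 * R ^ 3 * (x i * (a * x i + B * d i) * lam i)) := by ring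
        _ ≤ f i * (B / 2 * R ^ 2 * lam i ^ 2 + 121 / 2 * N * R ^ 4) :=
          mul_le_mul_of_nonneg_left (h4.trans h5) (hf i).le
        _ = B / 2 * R ^ 2 * (f i * lam i ^ 2) + f i * (121 / 2 * N * R ^ 4) := by ring
        _ ≤ B / 2 * R ^ 2 * (f i * lam i ^ 2) + 2 * (121 / 2 * N * R ^ 4) := by
          gcongr; exact hf2 i
        _ = _ := by ring
    calc -(8 / 9 * R ^ 3 * ∑ i, f i * (x i * (a * x i + B * d i) * lam i))
        = ∑ i, -(8 / 9 * R ^ 3 * (f i * (x i * (a * x i + B * d i) * lam i))) := by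
          rw [Finset.mul_sum, Finset.sum_neg_distrib]
      _ ≤ ∑ i, (B / 2 * R ^ 2 * (f i * lam i ^ 2) + 121 * N * R ^ 4) :=
          Finset.sum_le_sum fun i _ => this i
      _ = _ := by
        rw [Finset.sum_add_distrib, ← Finset.mul_sum]; simp; ring
  have e3 : -(a * G₁ + B * G₂) ≤ N := by
    have h1 := neg_le_of_abs_le hG₁
    have h2 := neg_le_of_abs_le hG₂
    have h3 := mul_le_mul_of_nonneg_left h1 ha.le
    have h4 := mul_le_mul_of_nonneg_left h2 hB.le
    linarith
  have e4 : -(R ^ 2 * (a * G₁ + B * G₂)) ≤ N * R ^ 4 := by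
    calc -(R ^ 2 * (a * G₁ + B * G₂)) = R ^ 2 * -(a * G₁ + B * G₂) := by ring
      _ ≤ R ^ 2 * N := by gcongr
      _ ≤ R ^ 4 * N := by gcongr
      _ = _ := by ring
  have e5 : C ≤ N * R ^ 4 := hC.trans (le_mul_of_one_le_right hN hR4)
  have e6 : N * R ^ 4 ≤ n * N * R ^ 4 := by
    have : 0 ≤ N * R ^ 4 := by positivity
    calc N * R ^ 4 ≤ n * (N * R ^ 4) := le_mul_of_one_le_left this hn'
      _ = _ := by ring
  have e7 : 0 ≤ n * N * R ^ 4 := by positivity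
  rw [mul_add, mul_add] at hmax
  linarith

/-- If some eigenvalue is below `-(c / 2) w`, then `∑ fᵢ λᵢ²` is of order `w²` and outweighs the
degenerate gradient term of the Jacobi inequality. -/
theorem le_of_very_negative_eigenvalue (hw : 1 ≤ w) (hg : 0 < g)
    (h2 : ∑ i, lam i ^ 2 = w ^ 2 - 2 * g * w) (hR : 1 ≤ R) (hd : ∀ i, |d i| ≤ M)
    (hx : ∀ i, |x i| ≤ 3) (hE0 : 0 ≤ E) (hE : E ≤ 2 * N) (ha : 0 < a) (hB : 0 < B)
    (hBM : B * M ≤ a) (hc : 0 < c) (hC : 0 ≤ C)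
    (hb : ∀ i, b i = 4 / 9 * R ^ 3 * x i * E - R ^ 2 * (a * x i + B * d i) * lam i)
    (hmax : -(C / w) * ∑ i, (1 - g / w - lam i / w) * b i ^ 2
      + B / 2 * R ^ 2 * ∑ i, (1 - g / w - lam i / w) * lam i ^ 2 ≤ 140 * n * N * R ^ 4)
    {k : Fin n} (hk : lam k < -(c / 2) * w) :
    w ≤ 16 / (B * c ^ 2) * (140 * n * N + 2 * n * C * (3 * N + 4 * a) ^ 2) * R ^ 4 := by
  have hw0 : 0 < w := by linarith
  have hfk : 1 / 2 ≤ 1 - g / w - lam k / w :=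
    half_le_coeff hw0 h2 (hk.le.trans (by
      have : 0 < c / 2 * w := by positivity
      linarith))
  have hf := coeff_pos hw0 hg h2
  have hf2 := coeff_le_two hw0 hg h2
  have hlam := abs_le_of_sum_sq hw0 hg h2
  generalize hfd : (fun i => 1 - g / w - lam i / w) = f at *
  have hfd' : ∀ i, 1 - g / w - lam i / w = f i := fun i => congrFun hfd i
  simp only [hfd'] at *
  clear hfd hfd'
  have hR0 : 0 < R := by linarith
  have hN : 0 ≤ N := by linarith
  have hT : c ^ 2 / 8 * w ^ 2 ≤ ∑ i, f i * lam i ^ 2 := by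
    have h1 : (c / 2 * w) ^ 2 ≤ lam k ^ 2 := by
      rw [← neg_sq (lam k)]
      exact pow_le_pow_left₀ (by positivity) (by linarith) 2
    calc c ^ 2 / 8 * w ^ 2 = 1 / 2 * (c / 2 * w) ^ 2 := by ring
      _ ≤ f k * lam k ^ 2 := by gcongr
      _ ≤ _ := Finset.single_le_sum (f := fun i => f i * lam i ^ 2)
        (fun i _ => mul_nonneg (hf i).le (sq_nonneg _)) (Finset.mem_univ k)
  have hbi : ∀ i, |b i| ≤ (3 * N + 4 * a) * R ^ 3 * w := by
    intro i
    have h1 := abs_add_le_four_mul ha hB hBM (hx i) (hd i)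
    have hR2 : R ^ 2 ≤ R ^ 3 := pow_le_pow_right₀ hR (by norm_num)
    have h3 : |4 / 9 * R ^ 3 * x i * E| ≤ 3 * N * R ^ 3 * w := by
      rw [abs_mul, abs_mul, abs_of_nonneg hE0, abs_of_nonneg (by positivity : 0 ≤ 4 / 9 * R ^ 3)]
      calc 4 / 9 * R ^ 3 * |x i| * E ≤ 4 / 9 * R ^ 3 * 3 * (2 * N) := by gcongr; exact hx i
        _ ≤ 3 * N * R ^ 3 := by
          have : 0 ≤ N * R ^ 3 := by positivity
          linarith
        _ ≤ _ := le_mul_of_one_le_right (by positivity) hw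
    have h4 : |R ^ 2 * (a * x i + B * d i) * lam i| ≤ 4 * a * R ^ 3 * w := by
      rw [abs_mul, abs_mul, abs_of_nonneg (by positivity : 0 ≤ R ^ 2)]
      calc R ^ 2 * |a * x i + B * d i| * |lam i| ≤ R ^ 3 * (4 * a) * w := by
            gcongr; exact hlam i
        _ = _ := by ring
    rw [hb i]
    calc _ ≤ |4 / 9 * R ^ 3 * x i * E| + |R ^ 2 * (a * x i + B * d i) * lam i| := abs_sub _ _
      _ ≤ _ := by linarith
  have hS : C / w * ∑ i, f i * b i ^ 2 ≤ 2 * n * C * (3 * N + 4 * a) ^ 2 * R ^ 6 * w := by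
    calc C / w * ∑ i, f i * b i ^ 2
        ≤ C / w * ∑ _i : Fin n, 2 * ((3 * N + 4 * a) * R ^ 3 * w) ^ 2 := by
          refine mul_le_mul_of_nonneg_left (Finset.sum_le_sum fun i _ => ?_) (by positivity)
          exact mul_le_mul (hf2 i)
            (sq_le_sq' (neg_le_of_abs_le (hbi i)) (le_of_abs_le (hbi i))) (sq_nonneg _)
            (by norm_num)
      _ = _ := by simp; field_simp
  have h1 : B / 2 * R ^ 2 * (c ^ 2 / 8 * w ^ 2) ≤ B / 2 * R ^ 2 * ∑ i, f i * lam i ^ 2 := by gcongr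
  have h3 : 140 * n * N * R ^ 4 ≤ 140 * n * N * (R ^ 6 * w) := by
    gcongr
    calc R ^ 4 ≤ R ^ 6 := pow_le_pow_right₀ hR (by norm_num)
      _ ≤ R ^ 6 * w := le_mul_of_one_le_right (by positivity) hw
  have h4 : (R ^ 2 * w) * (B * c ^ 2 / 16 * w)
      ≤ (R ^ 2 * w) * ((140 * n * N + 2 * n * C * (3 * N + 4 * a) ^ 2) * R ^ 4) := by linarith
  have h5 := le_of_mul_le_mul_left h4 (by positivity)
  calc w = 16 / (B * c ^ 2) * (B * c ^ 2 / 16 * w) := by field_simp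
    _ ≤ 16 / (B * c ^ 2) * ((140 * n * N + 2 * n * C * (3 * N + 4 * a) ^ 2) * R ^ 4) := by gcongr
    _ = _ := by ring

/-- If the Jacobi inequality has a definite gain `ε`, a large `w` contradicts the conditions at a
maximum point outside the unit ball. In every direction but that of the largest eigenvalue `λⱼ`,
ellipticity forces the component of `x` to be small; hence `xⱼ² ≥ 1 / 2`, and then `fⱼ bⱼ²` is at
least of the order `a² R⁴ fⱼ λⱼ²`, which `haL` makes too large. -/
theorem le_of_gradient_control (hn : 1 ≤ n) (hw : 0 < w) (hg : 0 < g) (hL : 0 < L)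
    (hgL : 1 / L ≤ g) (h1 : ∑ i, lam i = w)
    (h2 : ∑ i, lam i ^ 2 = w ^ 2 - 2 * g * w) (hR : 1 ≤ R) (hd : ∀ i, |d i| ≤ M)
    (hx : ∀ i, |x i| ≤ 3) (hx1 : 1 ≤ ∑ i, x i ^ 2) (hN : 0 < N) (hE0 : N / 2 ≤ E)
    (hE : E ≤ 2 * N) (ha : 0 < a) (hB : 0 < B) (hBM : 4 * (B * M) ≤ a) (hε : 0 < ε)
    (hNε : 181440 * n ^ 2 / ε ≤ N) (hBa : 5806080 * n ^ 2 * a ^ 2 ≤ B * N)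
    (haL : 8960 * n ^ 3 * L ^ 2 * N / ε < a ^ 2)
    (hb : ∀ i, b i = 4 / 9 * R ^ 3 * x i * E - R ^ 2 * (a * x i + B * d i) * lam i)
    (hmax : ε * ∑ i, (1 - g / w - lam i / w) * b i ^ 2
      + B / 2 * R ^ 2 * ∑ i, (1 - g / w - lam i / w) * lam i ^ 2 ≤ 140 * n * N * R ^ 4) :
    w ≤ 16 * n * N / a * R ^ 4 := by
  by_contra! hlt
  have hn' : (1 : ℝ) ≤ n := by exact_mod_cast hn
  have hn0 : (0 : ℝ) < n := by linarith
  have : Nonempty (Fin n) := ⟨⟨0, hn⟩⟩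
  obtain ⟨j, hj⟩ := Finite.exists_max lam
  have hf := coeff_pos hw hg h2
  have hf2 := coeff_le_two hw hg h2
  have hf8 : ∀ k, k ≠ j → 1 / 8 ≤ 1 - g / w - lam k / w := fun k hk =>
    eighth_le_coeff hw hg h2 hk (hj k)
  have hfj := coeff_mul_sq_ge hw hg h1 h2 hj
  have hlj := div_le_of_max h1 hj
  generalize hfd : (fun i => 1 - g / w - lam i / w) = f at *
  have hfd' : ∀ i, 1 - g / w - lam i / w = f i := fun i => congrFun hfd i
  simp only [hfd'] at *
  clear hfd hfd'
  have hR0 : 0 < R := by linarith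
  have hb0 : ∀ i, 0 ≤ f i * b i ^ 2 := fun i => mul_nonneg (hf i).le (sq_nonneg _)
  have hl0 : ∀ i, 0 ≤ f i * lam i ^ 2 := fun i => mul_nonneg (hf i).le (sq_nonneg _)
  have hS0 := Finset.sum_nonneg fun i (_ : i ∈ Finset.univ) => hb0 i
  have hT0 := Finset.sum_nonneg fun i (_ : i ∈ Finset.univ) => hl0 i
  have hbi : ∀ i, f i * b i ^ 2 ≤ 140 * n * N * R ^ 4 / ε := by
    intro i
    refine (Finset.single_le_sum (f := fun i => f i * b i ^ 2) (fun i _ => hb0 i)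
      (Finset.mem_univ i)).trans ?_
    rw [le_div_iff₀ hε]
    have : 0 ≤ B / 2 * R ^ 2 * ∑ i, f i * lam i ^ 2 := by positivity
    linarith
  have hli : ∀ i, f i * lam i ^ 2 ≤ 280 * n * N * R ^ 2 / B := by
    intro i
    refine (Finset.single_le_sum (f := fun i => f i * lam i ^ 2) (fun i _ => hl0 i)
      (Finset.mem_univ i)).trans ?_
    rw [le_div_iff₀ hB]
    have h3 : 0 ≤ ε * ∑ i, f i * b i ^ 2 := by positivity
    have h4 : (R ^ 2 / 2) * ((∑ i, f i * lam i ^ 2) * B) ≤ R ^ 2 / 2 * (280 * n * N * R ^ 2) := by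
      linarith
    exact le_of_mul_le_mul_left h4 (by positivity)
  have hBM' : B * M ≤ a := by
    have : 0 ≤ B * M := mul_nonneg hB.le ((abs_nonneg _).trans (hd j))
    linarith
  have hQ : ∀ i, (a * x i + B * d i) ^ 2 ≤ 16 * a ^ 2 := by
    intro i
    have h1 := abs_add_le_four_mul ha hB hBM' (hx i) (hd i)
    calc (a * x i + B * d i) ^ 2 ≤ (4 * a) ^ 2 :=
          sq_le_sq' (neg_le_of_abs_le h1) (le_of_abs_le h1)
      _ = _ := by ring
  -- the critical point equation `hb` is solved for `x k`
  have hx2 : ∀ k, k ≠ j → x k ^ 2 ≤ 1 / (2 * n) := by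
    intro k hk
    have h3 : lam k ^ 2 ≤ 2240 * n * N * R ^ 2 / B := by
      have : 1 / 8 * lam k ^ 2 ≤ f k * lam k ^ 2 := by gcongr; exact hf8 k hk
      have h4 := hli k
      have h5 : 2240 * n * N * R ^ 2 / B = 8 * (280 * n * N * R ^ 2 / B) := by ring
      linarith
    have h4 : b k ^ 2 ≤ 1120 * n * N * R ^ 4 / ε := by
      have : 1 / 8 * b k ^ 2 ≤ f k * b k ^ 2 := by gcongr; exact hf8 k hk
      have h4 := hbi k
      have h5 : 1120 * n * N * R ^ 4 / ε = 8 * (140 * n * N * R ^ 4 / ε) := by ring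
      linarith
    have h5 : (4 / 9 * R ^ 3 * x k * E) ^ 2
        ≤ 2 * b k ^ 2 + 2 * (R ^ 2 * (a * x k + B * d k) * lam k) ^ 2 := by
      have : 4 / 9 * R ^ 3 * x k * E = b k + R ^ 2 * (a * x k + B * d k) * lam k := by
        rw [hb k]; ring
      rw [this]
      linarith [sq_nonneg (b k - R ^ 2 * (a * x k + B * d k) * lam k)]
    have h6 : (R ^ 2 * (a * x k + B * d k) * lam k) ^ 2
        ≤ R ^ 4 * (16 * a ^ 2) * (2240 * n * N * R ^ 2 / B) := by
      calc (R ^ 2 * (a * x k + B * d k) * lam k) ^ 2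
          = R ^ 4 * (a * x k + B * d k) ^ 2 * lam k ^ 2 := by ring
        _ ≤ _ := by gcongr; exact hQ k
    have h7 : R ^ 6 * (4 / 81 * N ^ 2 * x k ^ 2) ≤ (4 / 9 * R ^ 3 * x k * E) ^ 2 := by
      calc R ^ 6 * (4 / 81 * N ^ 2 * x k ^ 2) = 16 / 81 * R ^ 6 * x k ^ 2 * (N / 2) ^ 2 := by ring
        _ ≤ 16 / 81 * R ^ 6 * x k ^ 2 * E ^ 2 := by gcongr
        _ = _ := by ring
    have h8 : 2 * (1120 * n * N * R ^ 4 / ε) ≤ R ^ 6 * (N ^ 2 / (81 * n)) := by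
      calc 2 * (1120 * n * N * R ^ 4 / ε)
          = R ^ 4 * (N / (81 * n)) * (181440 * n ^ 2 / ε) := by field_simp; norm_num
        _ ≤ R ^ 6 * (N / (81 * n)) * N := by gcongr; norm_num
        _ = _ := by ring
    have h9 : 2 * (R ^ 4 * (16 * a ^ 2) * (2240 * n * N * R ^ 2 / B))
        ≤ R ^ 6 * (N ^ 2 / (81 * n)) := by
      calc 2 * (R ^ 4 * (16 * a ^ 2) * (2240 * n * N * R ^ 2 / B))
          = R ^ 6 * (N / (81 * n)) * (5806080 * n ^ 2 * a ^ 2 / B) := by field_simp; norm_num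
        _ ≤ R ^ 6 * (N / (81 * n)) * N := by
          gcongr
          rw [div_le_iff₀ hB]; linarith
        _ = _ := by ring
    have h10 : R ^ 6 * (4 / 81 * N ^ 2 * x k ^ 2) ≤ R ^ 6 * (2 * (N ^ 2 / (81 * n))) := by linarith
    have h11 := le_of_mul_le_mul_left h10 (by positivity)
    have h12 : 4 / 81 * N ^ 2 * x k ^ 2 ≤ 4 / 81 * N ^ 2 * (1 / (2 * n)) := by
      refine h11.trans_eq ?_
      field_simp
      norm_num
    exact le_of_mul_le_mul_left h12 (by positivity)
  have hxj : 1 / 2 ≤ x j ^ 2 := by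
    have h3 : ∑ i, x i ^ 2 = x j ^ 2 + ∑ i ∈ Finset.univ.erase j, x i ^ 2 :=
      (Finset.add_sum_erase _ _ (Finset.mem_univ j)).symm
    have h4 : ∑ i ∈ Finset.univ.erase j, x i ^ 2 ≤ ∑ _i : Fin n, 1 / (2 * (n : ℝ)) :=
      (Finset.sum_le_sum fun i hi => hx2 i (Finset.ne_of_mem_erase hi)).trans
        (Finset.sum_le_sum_of_subset_of_nonneg (Finset.subset_univ _) fun _ _ _ => by positivity)
    have h5 : ∑ _i : Fin n, 1 / (2 * (n : ℝ)) = 1 / 2 := by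
      simp; field_simp
    linarith
  have hQj : a ^ 2 / 8 ≤ (a * x j + B * d j) ^ 2 := by
    have h3 : (B * d j) ^ 2 ≤ (a / 4) ^ 2 := by
      apply sq_le_sq'
      · have := mul_le_mul_of_nonneg_left (neg_le_of_abs_le (hd j)) hB.le
        linarith
      · have := mul_le_mul_of_nonneg_left (le_of_abs_le (hd j)) hB.le
        linarith
    have h4 : a ^ 2 * (1 / 2) ≤ a ^ 2 * x j ^ 2 := by gcongr
    linarith [sq_nonneg (a * x j + 2 * (B * d j)), sq_nonneg (a * x j), sq_nonneg a]
  have hlam : 16 * N / a * R ^ 4 ≤ lam j := by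
    refine le_trans ?_ hlj
    rw [le_div_iff₀ hn0]
    refine le_trans (le_of_eq ?_) hlt.le
    ring
  -- since `lam j` is large, the cutoff contributes little to `b j`
  have h3 : 16 * N ^ 2 * R ^ 6 ≤ a ^ 2 * R ^ 4 * lam j ^ 2 / 16 := by
    have h4 : 16 * N / a * R ≤ lam j := by
      refine le_trans ?_ hlam
      gcongr
      exact le_self_pow₀ hR (by norm_num)
    calc 16 * N ^ 2 * R ^ 6 = a ^ 2 * R ^ 4 * (16 * N / a * R) ^ 2 / 16 := by field_simp
      _ ≤ _ := by gcongr
  have h4 : (4 / 9 * R ^ 3 * x j * E) ^ 2 ≤ 8 * N ^ 2 * R ^ 6 := by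
    have h9 : x j ^ 2 ≤ 9 := by
      rw [← sq_abs]; calc |x j| ^ 2 ≤ 3 ^ 2 := by gcongr; exact hx j
        _ = 9 := by norm_num
    calc (4 / 9 * R ^ 3 * x j * E) ^ 2 = 16 / 81 * R ^ 6 * x j ^ 2 * E ^ 2 := by ring
      _ ≤ 16 / 81 * R ^ 6 * 9 * (2 * N) ^ 2 := by gcongr; linarith
      _ ≤ _ := by
        have : 0 ≤ N ^ 2 * R ^ 6 := by positivity
        linarith
  have h5 : (R ^ 2 * (a * x j + B * d j) * lam j) ^ 2
      ≤ 2 * b j ^ 2 + 2 * (4 / 9 * R ^ 3 * x j * E) ^ 2 := by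
    rw [hb j]
    linarith [sq_nonneg (2 * (4 / 9 * R ^ 3 * x j * E) - R ^ 2 * (a * x j + B * d j) * lam j)]
  have h6 : a ^ 2 / 8 * R ^ 4 * lam j ^ 2 ≤ (R ^ 2 * (a * x j + B * d j) * lam j) ^ 2 := by
    calc a ^ 2 / 8 * R ^ 4 * lam j ^ 2 ≤ (a * x j + B * d j) ^ 2 * R ^ 4 * lam j ^ 2 := by gcongr
      _ = _ := by ring
  have h7 : a ^ 2 * R ^ 4 * lam j ^ 2 / 16 ≤ 2 * b j ^ 2 := by linarith
  have h8 : a ^ 2 * R ^ 4 / 16 * (1 / (2 * n ^ 2 * L ^ 2)) ≤ 2 * (140 * n * N * R ^ 4 / ε) := by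
    calc a ^ 2 * R ^ 4 / 16 * (1 / (2 * n ^ 2 * L ^ 2))
        = a ^ 2 * R ^ 4 / 16 * ((1 / L) ^ 2 / (2 * n ^ 2)) := by field_simp
      _ ≤ a ^ 2 * R ^ 4 / 16 * (g ^ 2 / (2 * n ^ 2)) := by gcongr
      _ ≤ a ^ 2 * R ^ 4 / 16 * (f j * lam j ^ 2) := by gcongr
      _ = f j * (a ^ 2 * R ^ 4 * lam j ^ 2 / 16) := by ring
      _ ≤ f j * (2 * b j ^ 2) := mul_le_mul_of_nonneg_left h7 (hf j).le
      _ = 2 * (f j * b j ^ 2) := by ring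
      _ ≤ _ := by gcongr; exact hbi j
  have h9 : R ^ 4 / (32 * n ^ 2 * L ^ 2) * a ^ 2
      ≤ R ^ 4 / (32 * n ^ 2 * L ^ 2) * (8960 * n ^ 3 * L ^ 2 * N / ε) := by
    calc R ^ 4 / (32 * n ^ 2 * L ^ 2) * a ^ 2
        = a ^ 2 * R ^ 4 / 16 * (1 / (2 * n ^ 2 * L ^ 2)) := by field_simp; norm_num
      _ ≤ _ := h8
      _ = _ := by field_simp; norm_num
  exact absurd (le_of_mul_le_mul_left h9 (by positivity)) (not_le.2 haL)

end MaximumPoint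

/-! ### The Jacobi inequality -/

/-- Among the entries of a symmetric cubic form, `T i i m` with `i ≠ m` occurs three times; the
entries with three distinct indices are dropped. -/
theorem sum_sq_symmetric_cubic_ge {n : ℕ} (T : Fin n → Fin n → Fin n → ℝ)
    (h₁ : ∀ i j k, T i j k = T j i k) (h₂ : ∀ i j k, T i j k = T i k j) :
    ∑ m, (3 * ∑ i, T i i m ^ 2 - 2 * T m m m ^ 2) ≤ ∑ i, ∑ j, ∑ k, T i j k ^ 2 := by
  have key : ∀ i j k, (if i = j then T i j k ^ 2 else 0)
      + (if i = k then (T i j k ^ 2 - if i = j then T i j k ^ 2 else 0) else 0)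
      + (if j = k then (T i j k ^ 2 - if i = j then T i j k ^ 2 else 0) else 0) ≤ T i j k ^ 2 := by
    intro i j k
    have := sq_nonneg (T i j k)
    by_cases hij : i = j <;> by_cases hik : i = k <;> by_cases hjk : j = k <;>
      simp [hij, hik, hjk]; simp_all
  have hsum := Finset.sum_le_sum fun i (_ : i ∈ Finset.univ) => Finset.sum_le_sum fun j
    (_ : j ∈ Finset.univ) => Finset.sum_le_sum fun k (_ : k ∈ Finset.univ) => key i j k
  refine le_trans (le_of_eq ?_) hsum
  simp only [Finset.sum_add_distrib, Finset.sum_ite_eq, Finset.mem_univ, if_true,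
    Finset.sum_sub_distrib]
  have e1 : ∑ i, ∑ j, ∑ k, (if i = j then T i j k ^ 2 else 0) = ∑ i, ∑ k, T i i k ^ 2 := by
    refine Finset.sum_congr rfl fun i _ => ?_
    rw [Finset.sum_comm]
    simp
  have e2 : ∑ i, ∑ j, T i j i ^ 2 = ∑ i, ∑ k, T i i k ^ 2 := by
    refine Finset.sum_congr rfl fun i _ => Finset.sum_congr rfl fun j _ => ?_
    rw [h₂]
  have e3 : ∑ i, ∑ j, T i j j ^ 2 = ∑ i, ∑ k, T i i k ^ 2 := by
    rw [Finset.sum_comm]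
    refine Finset.sum_congr rfl fun i _ => Finset.sum_congr rfl fun j _ => ?_
    rw [h₁, h₂]
  rw [e1, e2, e3, ← Finset.mul_sum, ← Finset.mul_sum, Finset.sum_comm]
  ring

/-- The Jacobi inequality for `b = log w`, `w = Δu`, in an eigenframe of the Hessian: `v` and `w₂`
are the first and second derivatives of `w`, `T` the third derivatives of `u`, `g'` and `g₂` the
gradient and the Laplacian of `g = ψ(x, u)`, and the right-hand sides are the linearized operator
applied to `b`. The first inequality has a gradient term whose negative coefficient tends to `0` as
`w → ∞`; the second has the positive coefficient `ε`. -/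
theorem jacobi_inequality {n : ℕ} (hn : 2 ≤ n) {K G C₀ : ℝ} (hK : 0 ≤ K) (hC₀ : 0 ≤ C₀) :
    ∃ ε : ℝ, 0 < ε ∧ ∃ C : ℝ, 0 ≤ C ∧ ∃ W : ℝ, 1 ≤ W ∧
      ∀ (lam v g' w₂ : Fin n → ℝ) (T : Fin n → Fin n → Fin n → ℝ) (w g g₂ : ℝ),
        W ≤ w → 0 < g → g ≤ K → (∀ i, |g' i| ≤ G) → |g₂| ≤ C₀ * w →
        ∑ i, lam i = w → ∑ i, lam i ^ 2 = w ^ 2 - 2 * g * w →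
        (∀ i j k, T i j k = T j i k) → (∀ i j k, T i j k = T i k j) →
        (∀ m, ∑ i, T i i m = v m) →
        (∀ m, ∑ i, lam i * T i i m = (w - g) * v m - w * g' m) →
        (w * ∑ i, (1 - g / w - lam i / w) * w₂ i = ∑ i, ∑ j, ∑ k, T i j k ^ 2 - ∑ m, v m ^ 2
          + 2 * ∑ m, g' m * v m + w * g₂) →
        (∀ i, -cConst n * w ≤ lam i) →
        (-(C / w) * ∑ i, (1 - g / w - lam i / w) * (v i / w) ^ 2 - C
          ≤ ∑ i, (1 - g / w - lam i / w) * (w₂ i / w - (v i / w) ^ 2)) ∧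
        ((∀ i, -(cConst n / 2) * w ≤ lam i) →
          ε * ∑ i, (1 - g / w - lam i / w) * (v i / w) ^ 2 - C
          ≤ ∑ i, (1 - g / w - lam i / w) * (w₂ i / w - (v i / w) ^ 2)) := by
  obtain ⟨ε, hε, C, hC, W, hW, H⟩ := cubic_form_lower_bound hn (G := G) hK
  refine ⟨ε, hε, n * C + C + C₀, by positivity, W, hW, ?_⟩
  intro lam v g' w₂ T w g g₂ hw hg hgK hg' hg₂ h1 h2 hT1 hT2 hv hlT hL hc
  have hw1 : 1 ≤ w := hW.trans hw
  have hw0 : 0 < w := by linarith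
  have hcub := sum_sq_symmetric_cubic_ge T hT1 hT2
  have hμ : ∑ i, lam i / w = 1 := by rw [← Finset.sum_div, h1, div_self hw0.ne']
  have hμ2 : ∑ i, (lam i / w) ^ 2 = 1 - 2 * (g / w) := by
    simp only [div_pow]
    rw [← Finset.sum_div, h2]; field_simp
  have hμT : ∀ m, ∑ i, lam i / w * T i i m = (1 - g / w) * v m - g' m := by
    intro m
    have : ∑ i, lam i / w * T i i m = (∑ i, lam i * T i i m) / w := by
      rw [Finset.sum_div]; exact Finset.sum_congr rfl fun i _ => by ring
    rw [this, hlT m]; field_simp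
  have HH := fun m => H m (fun i => T i i m) (fun i => lam i / w) (v m) w g (g' m) hw hg hgK (hg' m)
    hμ hμ2 (hv m) (hμT m)
  have hf := coeff_pos hw0 hg h2
  generalize hfd : (fun i => 1 - g / w - lam i / w) = f at *
  have hfd' : ∀ i, 1 - g / w - lam i / w = f i := fun i => congrFun hfd i
  simp only [hfd'] at *
  -- sum over the eigendirections and divide by `w ^ 2`; the `1` in `1 + e` accounts for the term
  -- `-(v i / w) ^ 2` of the Hessian of the logarithm
  have hconv : ∀ e : ℝ, (∀ m, (1 + e) * (f m * v m ^ 2) - C * w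
      ≤ 3 * ∑ i, T i i m ^ 2 - 2 * T m m m ^ 2 - v m ^ 2 + 2 * v m * g' m) →
      e * ∑ i, f i * (v i / w) ^ 2 - (n * C + C₀) ≤ ∑ i, f i * (w₂ i / w - (v i / w) ^ 2) := by
    intro e he
    have s1 := Finset.sum_le_sum fun m (_ : m ∈ Finset.univ) => he m
    have s2 : ∑ m, ((1 + e) * (f m * v m ^ 2) - C * w)
        = (1 + e) * ∑ m, f m * v m ^ 2 - n * C * w := by
      rw [Finset.sum_sub_distrib, ← Finset.mul_sum]; simp; ring
    have s3 : ∑ m, (3 * ∑ i, T i i m ^ 2 - 2 * T m m m ^ 2 - v m ^ 2 + 2 * v m * g' m)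
        = ∑ m, (3 * ∑ i, T i i m ^ 2 - 2 * T m m m ^ 2) - ∑ m, v m ^ 2
          + 2 * ∑ m, g' m * v m := by
      rw [Finset.mul_sum, ← Finset.sum_sub_distrib, ← Finset.sum_add_distrib]
      exact Finset.sum_congr rfl fun m _ => by ring
    have s4 : ∑ i, f i * (v i / w) ^ 2 = (∑ m, f m * v m ^ 2) / w ^ 2 := by
      rw [Finset.sum_div]; exact Finset.sum_congr rfl fun m _ => by ring
    have s5 : ∑ i, f i * (w₂ i / w - (v i / w) ^ 2)
        = (w * ∑ i, f i * w₂ i) / w ^ 2 - (∑ m, f m * v m ^ 2) / w ^ 2 := by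
      rw [Finset.mul_sum, Finset.sum_div, Finset.sum_div, ← Finset.sum_sub_distrib]
      exact Finset.sum_congr rfl fun m _ => by field_simp
    have s6 : -(C₀ * w) ≤ g₂ := neg_le_of_abs_le hg₂
    have s7 := mul_le_mul_of_nonneg_left s6 hw0.le
    have s8 : n * C * w ≤ n * C * w ^ 2 := by
      gcongr; exact le_self_pow₀ hw1 (by norm_num)
    rw [s4, s5, hL]
    have hw2 : 0 < w ^ 2 := by positivity
    rw [← sub_div, le_div_iff₀ hw2]
    have s9 : (e * ((∑ m, f m * v m ^ 2) / w ^ 2) - (n * C + C₀)) * w ^ 2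
        = e * (∑ m, f m * v m ^ 2) - (n * C + C₀) * w ^ 2 := by field_simp
    rw [s9]
    rw [s2, s3] at s1
    linarith
  have hle : ∀ c : ℝ, (∀ i, c * w ≤ lam i) → ∀ i, c ≤ lam i / w := fun c h i => by
    rw [le_div_iff₀ hw0]; exact h i
  have hS : 0 ≤ ∑ i, f i * (v i / w) ^ 2 :=
    Finset.sum_nonneg fun i _ => mul_nonneg (hf i).le (sq_nonneg _)
  constructor
  · have := hconv (-(C / w)) fun m => by
      have := (HH m).1 (hle _ hc m)
      rw [← sub_eq_add_neg]; exact this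
    refine le_trans ?_ this
    have h3 : (n * C + C + C₀) / w = C / w + (n * C + C₀) / w := by ring
    have h4 : 0 ≤ (n * C + C₀) / w * ∑ i, f i * (v i / w) ^ 2 := by positivity
    rw [h3]
    linarith
  · intro hc2
    have := hconv ε fun m => (HH m).2 (hle _ hc2 m)
    linarith

/-! ### Directional derivatives and restriction to lines -/

section DirectionalDerivative

variable {E : Type*} [NormedAddCommGroup E] [NormedSpace ℝ E]

/-- The derivative `∂ᵥf` of `f` in the fixed direction `v`, as a function of the point. -/
noncomputable def dirDeriv (v : E) (f : E → ℝ) (x : E) : ℝ := fderiv ℝ f x v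

variable {f g : E → ℝ} {s : Set E} {x v w : E}

theorem contDiffOn_dirDeriv {k m : WithTop ℕ∞} (hs : IsOpen s) (hf : ContDiffOn ℝ k f s)
    (hk : m + 1 ≤ k) (v : E) : ContDiffOn ℝ m (dirDeriv v f) s :=
  (hf.fderiv_of_isOpen hs hk).clm_apply contDiffOn_const

theorem dirDeriv_congr (hs : IsOpen s) (h : EqOn f g s) (v : E) :
    EqOn (dirDeriv v f) (dirDeriv v g) s := fun x hx => by
  simp only [dirDeriv, (h.eventuallyEq_of_mem (hs.mem_nhds hx)).fderiv_eq]

theorem dirDeriv_dirDeriv (hs : IsOpen s) (hf : ContDiffOn ℝ 2 f s) (hx : x ∈ s) :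
    dirDeriv v (dirDeriv w f) x = fderiv ℝ (fderiv ℝ f) x v w := by
  have h1 : DifferentiableAt ℝ (fderiv ℝ f) x :=
    ((hf.fderiv_of_isOpen hs (m := 1) (by norm_num)).differentiableOn
      (by norm_num)).differentiableAt (hs.mem_nhds hx)
  have h2 : dirDeriv w f = fun y => fderiv ℝ f y w := rfl
  rw [h2, dirDeriv, fderiv_clm_apply h1 (differentiableAt_const w)]
  simp

theorem dirDeriv_comm (hs : IsOpen s) (hf : ContDiffOn ℝ 2 f s) (v w : E) :
    EqOn (dirDeriv v (dirDeriv w f)) (dirDeriv w (dirDeriv v f)) s := fun x hx => by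
  rw [dirDeriv_dirDeriv hs hf hx, dirDeriv_dirDeriv hs hf hx]
  exact (hf.contDiffAt (hs.mem_nhds hx)).isSymmSndFDerivAt (by simp) v w

theorem hasDerivAt_line {t : ℝ} (hf : DifferentiableAt ℝ f (x + t • v)) :
    HasDerivAt (fun t : ℝ => f (x + t • v)) (dirDeriv v f (x + t • v)) t := by
  have h1 : HasDerivAt (fun t : ℝ => x + t • v) v t := by
    simpa using ((hasDerivAt_id t).smul_const v).const_add x
  exact hf.hasFDerivAt.comp_hasDerivAt t h1

theorem hasDerivAt_line_of_mem {k : WithTop ℕ∞} {t : ℝ} (hs : IsOpen s) (hf : ContDiffOn ℝ k f s)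
    (hk : k ≠ 0) (hx : x + t • v ∈ s) :
    HasDerivAt (fun t : ℝ => f (x + t • v)) (dirDeriv v f (x + t • v)) t :=
  hasDerivAt_line ((hf.differentiableOn hk).differentiableAt (hs.mem_nhds hx))

theorem eventually_line_mem (hs : IsOpen s) (hx : x ∈ s) (v : E) :
    ∀ᶠ t : ℝ in 𝓝 0, x + t • v ∈ s := by
  have : ContinuousAt (fun t : ℝ => x + t • v) 0 := by fun_prop
  exact this.eventually_mem (by simpa using hs.mem_nhds hx)

end DirectionalDerivative

/-- The first- and second-order necessary conditions at a local maximum, in terms of given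
derivatives. -/
theorem deriv_eq_zero_of_isLocalMax_and_nonpos {p p' : ℝ → ℝ} {p'' t₀ : ℝ}
    (h1 : ∀ᶠ t in 𝓝 t₀, HasDerivAt p (p' t) t) (h2 : HasDerivAt p' p'' t₀)
    (hmax : IsLocalMax p t₀) : p' t₀ = 0 ∧ p'' ≤ 0 := by
  have h0 := h1.self_of_nhds
  have hp' : p' t₀ = 0 := hmax.hasDerivAt_eq_zero h0
  refine ⟨hp', ?_⟩
  by_contra! hpos
  have hd : deriv p =ᶠ[𝓝 t₀] p' := h1.mono fun t ht => ht.deriv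
  have hdd : deriv (deriv p) t₀ = p'' := by rw [hd.deriv_eq, h2.deriv]
  have hmin := isLocalMin_of_deriv_deriv_pos (f := p) (x₀ := t₀) (by rw [hdd]; exact hpos)
    (by rw [h0.deriv, hp']) h0.continuousAt
  have hc : p =ᶠ[𝓝 t₀] fun _ => p t₀ := by
    filter_upwards [hmax, hmin] with t h3 h4 using le_antisymm h3 h4
  have h5 : deriv p =ᶠ[𝓝 t₀] fun _ => 0 := by
    filter_upwards [hc.eventuallyEq_nhds] with t ht
    rw [ht.deriv_eq]; simp
  have h6 : deriv (deriv p) t₀ = 0 := by rw [h5.deriv_eq]; simp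
  linarith

theorem deriv_eq_zero_of_eventually_zero {p p' : ℝ → ℝ} {p'' t₀ : ℝ}
    (h1 : ∀ᶠ t in 𝓝 t₀, HasDerivAt p (p' t) t) (h2 : HasDerivAt p' p'' t₀)
    (h : ∀ᶠ t in 𝓝 t₀, p t = 0) : p' t₀ = 0 ∧ p'' = 0 := by
  have h3 : ∀ᶠ t in 𝓝 t₀, p' t = 0 := by
    filter_upwards [h1, h.eventually_nhds] with t ht ht0
    have : p =ᶠ[𝓝 t] fun _ => 0 := ht0
    exact ht.unique ((hasDerivAt_const t (0 : ℝ)).congr_of_eventuallyEq this)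
  refine ⟨h3.self_of_nhds, ?_⟩
  exact h2.unique ((hasDerivAt_const t₀ (0 : ℝ)).congr_of_eventuallyEq h3)

/-- The necessary conditions at a maximum of the test function, on a line `x + t v` with `‖v‖ = 1`:
`ρ = ‖x‖²`, `ξ` is the component of `x` along `v`, and `W`, `Z`, `Y` are the restrictions of `Δu`,
`x · ∇u - u` and `|∇u|² / 2`. -/
theorem line_max_conditions {W W' Z Z' Y Y' : ℝ → ℝ} {w₂ z₂ y₂ ρ ξ N a B : ℝ} (hρ : ρ < 9)
    (hW0 : 0 < W 0)
    (hW : ∀ᶠ t in 𝓝 0, HasDerivAt W (W' t) t) (hW' : HasDerivAt W' w₂ 0)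
    (hZ : ∀ᶠ t in 𝓝 0, HasDerivAt Z (Z' t) t) (hZ' : HasDerivAt Z' z₂ 0)
    (hY : ∀ᶠ t in 𝓝 0, HasDerivAt Y (Y' t) t) (hY' : HasDerivAt Y' y₂ 0)
    (hmax : IsLocalMax (fun t => Real.log (W t)
      - (9 / (9 - (ρ + 2 * t * ξ + t ^ 2))) ^ 2 * (N - a * Z t - B * Y t)) 0) :
    W' 0 / W 0 = 4 / 9 * (9 / (9 - ρ)) ^ 3 * ξ * (N - a * Z 0 - B * Y 0)
      - (9 / (9 - ρ)) ^ 2 * (a * Z' 0 + B * Y' 0) ∧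
    w₂ / W 0 - (W' 0 / W 0) ^ 2
      - (N - a * Z 0 - B * Y 0) * (4 / 9 * (9 / (9 - ρ)) ^ 3 + 8 / 27 * (9 / (9 - ρ)) ^ 4 * ξ ^ 2)
      + 8 / 9 * (9 / (9 - ρ)) ^ 3 * ξ * (a * Z' 0 + B * Y' 0)
      + (9 / (9 - ρ)) ^ 2 * (a * z₂ + B * y₂) ≤ 0 := by
  obtain ⟨R, hRdef⟩ : ∃ R : ℝ → ℝ, R = fun t => 9 / (9 - (ρ + 2 * t * ξ + t ^ 2)) := ⟨_, rfl⟩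
  have hR0 : R 0 = 9 / (9 - ρ) := by simp [hRdef]
  have hpos : ∀ᶠ t : ℝ in 𝓝 0, 0 < 9 - (ρ + 2 * t * ξ + t ^ 2) := by
    have : ContinuousAt (fun t : ℝ => 9 - (ρ + 2 * t * ξ + t ^ 2)) 0 := by fun_prop
    exact this.tendsto.eventually_const_lt (by simpa using hρ)
  have hR : ∀ᶠ t in 𝓝 0, HasDerivAt R (2 / 9 * R t ^ 2 * (ξ + t)) t := by
    filter_upwards [hpos] with t ht
    have h1 : HasDerivAt (fun t : ℝ => 9 - (ρ + 2 * t * ξ + t ^ 2)) (-(2 * ξ + 2 * t)) t := by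
      have := (((((hasDerivAt_id t).const_mul 2).mul_const ξ).const_add ρ).add
        (hasDerivAt_pow 2 t)).const_sub 9
      convert! this using 1
      simp
    have h2 := (hasDerivAt_const t (9 : ℝ)).div h1 ht.ne'
    rw [hRdef]
    convert! h2 using 1
    simp only
    field_simp
    ring
  have hWpos : ∀ᶠ t in 𝓝 0, 0 < W t :=
    hW.self_of_nhds.continuousAt.tendsto.eventually_const_lt hW0
  have hp : ∀ᶠ t in 𝓝 0, HasDerivAt (fun t => Real.log (W t) - R t ^ 2 * (N - a * Z t - B * Y t))
      (W' t / W t - (4 / 9 * R t ^ 3 * (ξ + t) * (N - a * Z t - B * Y t)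
        - R t ^ 2 * (a * Z' t + B * Y' t))) t := by
    filter_upwards [hR, hW, hZ, hY, hWpos] with t h1 h2 h3 h4 h5
    have := (h2.log h5.ne').sub ((h1.pow 2).mul
      (((h3.const_mul a).const_sub N).sub (h4.const_mul B)))
    convert! this using 1
    simp
    ring
  have hp' : HasDerivAt (fun t => W' t / W t - (4 / 9 * R t ^ 3 * (ξ + t) * (N - a * Z t - B * Y t)
        - R t ^ 2 * (a * Z' t + B * Y' t)))
      (w₂ / W 0 - (W' 0 / W 0) ^ 2
      - (N - a * Z 0 - B * Y 0) * (4 / 9 * R 0 ^ 3 + 8 / 27 * R 0 ^ 4 * ξ ^ 2)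
      + 8 / 9 * R 0 ^ 3 * ξ * (a * Z' 0 + B * Y' 0)
      + R 0 ^ 2 * (a * z₂ + B * y₂)) 0 := by
    have h1 := hR.self_of_nhds
    have h2 := hW.self_of_nhds
    have h3 := hZ.self_of_nhds
    have h4 := hY.self_of_nhds
    have := (hW'.div h2 hW0.ne').sub
      ((((h1.pow 3).const_mul (4 / 9)).mul ((hasDerivAt_id (0 : ℝ)).const_add ξ) |>.mul
        (((h3.const_mul a).const_sub N).sub (h4.const_mul B))).sub
        ((h1.pow 2).mul ((hZ'.const_mul a).add (hY'.const_mul B))))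
    convert! this using 1
    simp
    field_simp
    ring
  have := deriv_eq_zero_of_isLocalMax_and_nonpos hp hp' (by rw [hRdef]; exact hmax)
  rw [hR0] at this
  refine ⟨?_, this.2⟩
  have h := this.1
  simp only [add_zero] at h
  linarith

/-! ### Differentiating the equation -/

section FrameDerivatives

variable {n : ℕ} {u g : EuclideanSpace ℝ (Fin n) → ℝ} {s : Set (EuclideanSpace ℝ (Fin n))}
  {x₀ : EuclideanSpace ℝ (Fin n)} (e : Fin n → EuclideanSpace ℝ (Fin n))

/-- The second derivatives `∂ⱼ∂ᵢu` in the frame `e`. -/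
noncomputable def hess (u : EuclideanSpace ℝ (Fin n) → ℝ) (i j : Fin n) :
    EuclideanSpace ℝ (Fin n) → ℝ := dirDeriv (e j) (dirDeriv (e i) u)

/-- The trace `∑ᵢ ∂ᵢ∂ᵢu` of the Hessian in the frame `e`. -/
noncomputable def hessTrace (u : EuclideanSpace ℝ (Fin n) → ℝ) :
    EuclideanSpace ℝ (Fin n) → ℝ := fun x => ∑ i, hess e u i i x

/-- The third derivatives `∂ₖ∂ⱼ∂ᵢu` in the frame `e`. -/
noncomputable def thirdDeriv (u : EuclideanSpace ℝ (Fin n) → ℝ) (i j k : Fin n) :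
    EuclideanSpace ℝ (Fin n) → ℝ := dirDeriv (e k) (hess e u i j)

variable {e}

theorem dirDeriv_sum {ι : Type*} (t : Finset ι) {f : ι → EuclideanSpace ℝ (Fin n) → ℝ}
    (v : EuclideanSpace ℝ (Fin n)) {x : EuclideanSpace ℝ (Fin n)}
    (hf : ∀ i ∈ t, DifferentiableAt ℝ (f i) x) :
    dirDeriv v (fun y => ∑ i ∈ t, f i y) x = ∑ i ∈ t, dirDeriv v (f i) x := by
  simp only [dirDeriv]
  rw [fderiv_fun_sum hf]
  simp

section

variable (hs : IsOpen s) (hu : ContDiffOn ℝ 4 u s)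
include hs hu

theorem contDiffOn_frame_one (i : Fin n) : ContDiffOn ℝ 3 (dirDeriv (e i) u) s :=
  contDiffOn_dirDeriv hs hu (by norm_num) _

theorem contDiffOn_hess (i j : Fin n) : ContDiffOn ℝ 2 (hess e u i j) s :=
  contDiffOn_dirDeriv hs (contDiffOn_frame_one hs hu i) (by norm_num) _

theorem contDiffOn_hessTrace : ContDiffOn ℝ 2 (hessTrace e u) s :=
  ContDiffOn.sum fun i _ => contDiffOn_hess hs hu i i

theorem contDiffOn_thirdDeriv (i j k : Fin n) : ContDiffOn ℝ 1 (thirdDeriv e u i j k) s :=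
  contDiffOn_dirDeriv hs (contDiffOn_hess hs hu i j) (by norm_num) _

theorem hess_symm (i j : Fin n) : EqOn (hess e u i j) (hess e u j i) s :=
  dirDeriv_comm hs (hu.of_le (by norm_num)) _ _

theorem thirdDeriv_symm_left (i j k : Fin n) :
    EqOn (thirdDeriv e u i j k) (thirdDeriv e u j i k) s :=
  dirDeriv_congr hs (hess_symm hs hu i j) _

theorem thirdDeriv_symm_right (i j k : Fin n) :
    EqOn (thirdDeriv e u i j k) (thirdDeriv e u i k j) s :=
  dirDeriv_comm hs ((contDiffOn_frame_one hs hu i).of_le (by norm_num)) _ _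

/-- The fourth derivatives `∂ₘ∂ₘ∂ᵢ∂ᵢu` and `∂ᵢ∂ᵢ∂ₘ∂ₘu` agree. -/
theorem dirDeriv_thirdDeriv_symm (i m : Fin n) :
    EqOn (dirDeriv (e m) (thirdDeriv e u i i m)) (dirDeriv (e i) (thirdDeriv e u m m i)) s := by
  have h1 : EqOn (thirdDeriv e u i i m) (dirDeriv (e i) (hess e u m i)) s := fun x hx => by
    rw [thirdDeriv_symm_right hs hu i i m hx, thirdDeriv_symm_left hs hu i m i hx]; rfl
  have h2 : EqOn (thirdDeriv e u m m i) (dirDeriv (e m) (hess e u m i)) s := fun x hx => by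
    rw [thirdDeriv_symm_right hs hu m m i hx]; rfl
  intro x hx
  rw [dirDeriv_congr hs h1 _ hx, dirDeriv_congr hs h2 _ hx]
  exact dirDeriv_comm hs (contDiffOn_hess hs hu m i) _ _ hx

theorem dirDeriv_hessTrace (m : Fin n) :
    EqOn (dirDeriv (e m) (hessTrace e u)) (fun x => ∑ i, thirdDeriv e u i i m x) s := fun x hx => by
  refine dirDeriv_sum _ _ fun i _ => ?_
  exact ((contDiffOn_hess hs hu i i).differentiableOn (by norm_num)).differentiableAt
    (hs.mem_nhds hx)

theorem dirDeriv_dirDeriv_hessTrace (m : Fin n) :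
    EqOn (dirDeriv (e m) (dirDeriv (e m) (hessTrace e u)))
      (fun x => ∑ i, dirDeriv (e i) (thirdDeriv e u m m i) x) s := fun x hx => by
  rw [dirDeriv_congr hs (dirDeriv_hessTrace hs hu m) _ hx]
  rw [dirDeriv_sum _ _ fun i _ => ((contDiffOn_thirdDeriv hs hu i i m).differentiableOn
    (by norm_num)).differentiableAt (hs.mem_nhds hx)]
  exact Finset.sum_congr rfl fun i _ => dirDeriv_thirdDeriv_symm hs hu i m hx

end

/-- The equation `σ₁² - |D²u|² = 2 g σ₁`, differentiated once and twice in the direction `e m`. -/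
theorem differentiated_equation (hs : IsOpen s) (hu : ContDiffOn ℝ 4 u s) (hg : ContDiffOn ℝ 2 g s)
    (hx₀ : x₀ ∈ s)
    (heq : ∀ x ∈ s, hessTrace e u x ^ 2 - ∑ i, ∑ j, hess e u i j x ^ 2
      = 2 * g x * hessTrace e u x) (m : Fin n) :
    (∑ i, ∑ j, hess e u i j x₀ * thirdDeriv e u i j m x₀
      = (hessTrace e u x₀ - g x₀) * dirDeriv (e m) (hessTrace e u) x₀
        - hessTrace e u x₀ * dirDeriv (e m) g x₀) ∧
    (hessTrace e u x₀ - g x₀) * dirDeriv (e m) (dirDeriv (e m) (hessTrace e u)) x₀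
        - ∑ i, ∑ j, hess e u i j x₀ * dirDeriv (e m) (thirdDeriv e u i j m) x₀
      = ∑ i, ∑ j, thirdDeriv e u i j m x₀ ^ 2 - dirDeriv (e m) (hessTrace e u) x₀ ^ 2
        + 2 * (dirDeriv (e m) g x₀ * dirDeriv (e m) (hessTrace e u) x₀)
        + hessTrace e u x₀ * dirDeriv (e m) (dirDeriv (e m) g) x₀ := by
  have hW := contDiffOn_hessTrace (e := e) hs hu
  have hW' := contDiffOn_dirDeriv hs hW (m := 1) (by norm_num) (e m)
  have hg' := contDiffOn_dirDeriv hs hg (m := 1) (by norm_num) (e m)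
  have hmem := eventually_line_mem hs hx₀ (e m)
  have hmem0 : x₀ + (0 : ℝ) • e m ∈ s := by simpa using hx₀
  have h1 : ∀ᶠ t : ℝ in 𝓝 0, HasDerivAt (fun t : ℝ => hessTrace e u (x₀ + t • e m) ^ 2
      - ∑ i, ∑ j, hess e u i j (x₀ + t • e m) ^ 2 - 2 * g (x₀ + t • e m) *
        hessTrace e u (x₀ + t • e m))
      (2 * hessTrace e u (x₀ + t • e m) * dirDeriv (e m) (hessTrace e u) (x₀ + t • e m)
        - ∑ i, ∑ j, 2 * hess e u i j (x₀ + t • e m) * thirdDeriv e u i j m (x₀ + t • e m)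
        - (2 * dirDeriv (e m) g (x₀ + t • e m) * hessTrace e u (x₀ + t • e m)
          + 2 * g (x₀ + t • e m) * dirDeriv (e m) (hessTrace e u) (x₀ + t • e m))) t := by
    filter_upwards [hmem] with t ht
    have a1 := hasDerivAt_line_of_mem hs hW (by norm_num) ht
    have a2 := hasDerivAt_line_of_mem hs hg (by norm_num) ht
    have a3 := fun i j => hasDerivAt_line_of_mem hs (contDiffOn_hess (e := e) hs hu i j)
      (by norm_num) ht
    have := ((a1.pow 2).sub (HasDerivAt.fun_sum fun i (_ : i ∈ Finset.univ) =>
      HasDerivAt.fun_sum fun j (_ : j ∈ Finset.univ) => (a3 i j).pow 2)).sub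
      ((a2.const_mul 2).mul a1)
    convert! this using 1
    simp [thirdDeriv]
  have h2 : HasDerivAt (fun t : ℝ =>
      2 * hessTrace e u (x₀ + t • e m) * dirDeriv (e m) (hessTrace e u) (x₀ + t • e m)
        - ∑ i, ∑ j, 2 * hess e u i j (x₀ + t • e m) * thirdDeriv e u i j m (x₀ + t • e m)
        - (2 * dirDeriv (e m) g (x₀ + t • e m) * hessTrace e u (x₀ + t • e m)
          + 2 * g (x₀ + t • e m) * dirDeriv (e m) (hessTrace e u) (x₀ + t • e m)))
      (2 * dirDeriv (e m) (hessTrace e u) x₀ ^ 2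
        + 2 * hessTrace e u x₀ * dirDeriv (e m) (dirDeriv (e m) (hessTrace e u)) x₀
        - (2 * ∑ i, ∑ j, thirdDeriv e u i j m x₀ ^ 2
          + 2 * ∑ i, ∑ j, hess e u i j x₀ * dirDeriv (e m) (thirdDeriv e u i j m) x₀)
        - (2 * dirDeriv (e m) (dirDeriv (e m) g) x₀ * hessTrace e u x₀
          + 4 * (dirDeriv (e m) g x₀ * dirDeriv (e m) (hessTrace e u) x₀)
          + 2 * g x₀ * dirDeriv (e m) (dirDeriv (e m) (hessTrace e u)) x₀)) 0 := by
    have a1 := hasDerivAt_line_of_mem hs hW (by norm_num) hmem0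
    have a1' := hasDerivAt_line_of_mem hs hW' (by norm_num) hmem0
    have a2 := hasDerivAt_line_of_mem hs hg (by norm_num) hmem0
    have a2' := hasDerivAt_line_of_mem hs hg' (by norm_num) hmem0
    have a3 := fun i j => hasDerivAt_line_of_mem hs (contDiffOn_hess (e := e) hs hu i j)
      (by norm_num) hmem0
    have a3' := fun i j => hasDerivAt_line_of_mem hs (contDiffOn_thirdDeriv (e := e) hs hu i j m)
      (by norm_num) hmem0
    have := (((a1.const_mul 2).mul a1').sub (HasDerivAt.fun_sum fun i (_ : i ∈ Finset.univ) =>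
      HasDerivAt.fun_sum fun j (_ : j ∈ Finset.univ) => ((a3 i j).const_mul 2).mul (a3' i j))).sub
      (((a2'.const_mul 2).mul a1).add ((a2.const_mul 2).mul a1'))
    convert! this using 1
    simp only [zero_smul, add_zero, Finset.sum_add_distrib, Finset.mul_sum]
    have c1 : ∀ i j, 2 * dirDeriv (e m) (hess e u i j) x₀ * thirdDeriv e u i j m x₀
        = 2 * thirdDeriv e u i j m x₀ ^ 2 := fun i j => by rw [thirdDeriv]; ring
    simp only [c1, ← mul_assoc]
    ring
  have h3 : ∀ᶠ t : ℝ in 𝓝 0, hessTrace e u (x₀ + t • e m) ^ 2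
      - ∑ i, ∑ j, hess e u i j (x₀ + t • e m) ^ 2 - 2 * g (x₀ + t • e m) *
        hessTrace e u (x₀ + t • e m) = 0 := by
    filter_upwards [hmem] with t ht
    rw [heq _ ht]; ring
  have h4 := deriv_eq_zero_of_eventually_zero h1 h2 h3
  constructor
  · have := h4.1
    simp only [zero_smul, add_zero, mul_assoc, ← Finset.mul_sum] at this
    linarith
  · linarith [h4.2]

/-- The differentiated equations in a frame that diagonalizes the Hessian at `x₀`. The second one,
summed over all directions, is the linearized operator applied to `Δu`. -/
theorem differentiated_equation_diagonal (hs : IsOpen s) (hu : ContDiffOn ℝ 4 u s)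
    (hg : ContDiffOn ℝ 2 g s) (hx₀ : x₀ ∈ s)
    (heq : ∀ x ∈ s, hessTrace e u x ^ 2 - ∑ i, ∑ j, hess e u i j x ^ 2
      = 2 * g x * hessTrace e u x) (hw : 0 < hessTrace e u x₀) {lam : Fin n → ℝ}
    (hlam : ∀ i j, hess e u i j x₀ = if i = j then lam i else 0) :
    (∀ m, ∑ i, lam i * thirdDeriv e u i i m x₀
      = (hessTrace e u x₀ - g x₀) * dirDeriv (e m) (hessTrace e u) x₀
        - hessTrace e u x₀ * dirDeriv (e m) g x₀) ∧
    hessTrace e u x₀ * ∑ i, (1 - g x₀ / hessTrace e u x₀ - lam i / hessTrace e u x₀) *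
        dirDeriv (e i) (dirDeriv (e i) (hessTrace e u)) x₀
      = ∑ i, ∑ j, ∑ k, thirdDeriv e u i j k x₀ ^ 2 - ∑ m, dirDeriv (e m) (hessTrace e u) x₀ ^ 2
        + 2 * ∑ m, dirDeriv (e m) g x₀ * dirDeriv (e m) (hessTrace e u) x₀
        + hessTrace e u x₀ * ∑ m, dirDeriv (e m) (dirDeriv (e m) g) x₀ := by
  have H := differentiated_equation hs hu hg hx₀ heq
  simp only [hlam, ite_mul, zero_mul, Finset.sum_ite_eq, Finset.mem_univ, if_true] at H
  refine ⟨fun m => (H m).1, ?_⟩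
  have hsum := Finset.sum_congr rfl fun m (_ : m ∈ Finset.univ) => (H m).2
  simp only [Finset.sum_add_distrib, Finset.sum_sub_distrib, ← Finset.mul_sum] at hsum
  have e1 : ∑ m, ∑ i, lam i * dirDeriv (e m) (thirdDeriv e u i i m) x₀
      = ∑ i, lam i * dirDeriv (e i) (dirDeriv (e i) (hessTrace e u)) x₀ := by
    rw [Finset.sum_comm]
    refine Finset.sum_congr rfl fun i _ => ?_
    rw [← Finset.mul_sum, dirDeriv_dirDeriv_hessTrace hs hu i hx₀]
  have e2 : ∑ m, ∑ i, ∑ j, thirdDeriv e u i j m x₀ ^ 2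
      = ∑ i, ∑ j, ∑ k, thirdDeriv e u i j k x₀ ^ 2 := by
    rw [Finset.sum_comm]
    exact Finset.sum_congr rfl fun i _ => Finset.sum_comm
  rw [e1, e2] at hsum
  rw [← hsum, Finset.mul_sum, Finset.mul_sum, ← Finset.sum_sub_distrib]
  refine Finset.sum_congr rfl fun i _ => ?_
  field_simp

end FrameDerivatives

/-! ### The test function -/

section TestFunction

variable {n : ℕ} {u g : EuclideanSpace ℝ (Fin n) → ℝ} {s : Set (EuclideanSpace ℝ (Fin n))}
  {x₀ : EuclideanSpace ℝ (Fin n)} (e : OrthonormalBasis (Fin n) ℝ (EuclideanSpace ℝ (Fin n)))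

theorem clm_apply_eq_sum (l : EuclideanSpace ℝ (Fin n) →L[ℝ] ℝ) (x : EuclideanSpace ℝ (Fin n)) :
    l x = ∑ k, inner ℝ (e k) x * l (e k) := by
  conv_lhs => rw [← e.sum_repr' x]
  simp

/-- Parseval for a functional, in the dual norm. -/
theorem sum_sq_clm_apply (l : EuclideanSpace ℝ (Fin n) →L[ℝ] ℝ) :
    ∑ k, l (e k) ^ 2 = ‖l‖ ^ 2 := by
  have h1 : ∀ x, l x = inner ℝ ((InnerProductSpace.toDual ℝ _).symm l) x := fun x => by simp
  have h2 : ‖l‖ = ‖(InnerProductSpace.toDual ℝ (EuclideanSpace ℝ (Fin n))).symm l‖ := by simp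
  rw [h2, ← e.sum_sq_norm_inner_left]
  refine Finset.sum_congr rfl fun k _ => ?_
  rw [h1, Real.norm_eq_abs, sq_abs]

/-- The test function `log w - R² (N - a (x · ∇u - u) - B |∇u|² / 2)` with `R = 9 / (9 - |x|²)`,
where `w` is the Laplacian of `u`. Since `R` tends to `∞` at the boundary of the ball of radius `3`,
the function tends to `-∞` there. -/
noncomputable def testFunction (N a B : ℝ) (w u : EuclideanSpace ℝ (Fin n) → ℝ)
    (x : EuclideanSpace ℝ (Fin n)) : ℝ :=
  Real.log (w x) - (9 / (9 - ‖x‖ ^ 2)) ^ 2 *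
    (N - a * (fderiv ℝ u x x - u x) - B * (‖fderiv ℝ u x‖ ^ 2 / 2))

variable {e}

/-- The critical-point equation and the second-order condition for the test function in each
direction of a frame that diagonalizes the Hessian at the maximum point. -/
theorem testFunction_max_conditions {N a B : ℝ} (hs : IsOpen s) (hu : ContDiffOn ℝ 4 u s)
    (hx₀ : x₀ ∈ s) (hx₃ : ‖x₀‖ < 3) (hw : 0 < hessTrace e u x₀) {lam : Fin n → ℝ}
    (hlam : ∀ i j, hess e u i j x₀ = if i = j then lam i else 0)
    (hmax : IsLocalMax (testFunction N a B (hessTrace e u) u) x₀) (m : Fin n) :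
    dirDeriv (e m) (hessTrace e u) x₀ / hessTrace e u x₀
      = 4 / 9 * (9 / (9 - ‖x₀‖ ^ 2)) ^ 3 * inner ℝ (e m) x₀ *
          (N - a * (fderiv ℝ u x₀ x₀ - u x₀) - B * (‖fderiv ℝ u x₀‖ ^ 2 / 2))
        - (9 / (9 - ‖x₀‖ ^ 2)) ^ 2 *
          (a * inner ℝ (e m) x₀ + B * dirDeriv (e m) u x₀) * lam m ∧
    dirDeriv (e m) (dirDeriv (e m) (hessTrace e u)) x₀ / hessTrace e u x₀
      - (dirDeriv (e m) (hessTrace e u) x₀ / hessTrace e u x₀) ^ 2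
      - (N - a * (fderiv ℝ u x₀ x₀ - u x₀) - B * (‖fderiv ℝ u x₀‖ ^ 2 / 2)) *
        (4 / 9 * (9 / (9 - ‖x₀‖ ^ 2)) ^ 3
          + 8 / 27 * (9 / (9 - ‖x₀‖ ^ 2)) ^ 4 * (inner ℝ (e m) x₀) ^ 2)
      + 8 / 9 * (9 / (9 - ‖x₀‖ ^ 2)) ^ 3 * (inner ℝ (e m) x₀ *
        (a * inner ℝ (e m) x₀ + B * dirDeriv (e m) u x₀) * lam m)
      + (9 / (9 - ‖x₀‖ ^ 2)) ^ 2 *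
        (a * (lam m + ∑ k, inner ℝ (e k) x₀ * thirdDeriv e u k m m x₀)
          + B * (lam m ^ 2 + ∑ k, dirDeriv (e k) u x₀ * thirdDeriv e u k m m x₀)) ≤ 0 := by
  have hW := contDiffOn_hessTrace (e := e) hs hu
  have hW' := contDiffOn_dirDeriv hs hW (m := 1) (by norm_num) (e m)
  have hmem := eventually_line_mem hs hx₀ (e m)
  have hmem0 : x₀ + (0 : ℝ) • e m ∈ s := by simpa using hx₀
  have hip : ∀ (k : Fin n) (t : ℝ), HasDerivAt (fun t : ℝ => inner ℝ (e k) x₀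
      + t * (if k = m then 1 else 0)) (if k = m then 1 else 0) t := fun k t => by
    simpa using ((hasDerivAt_id t).mul_const (if k = m then (1 : ℝ) else 0)).const_add
      (inner ℝ (e k) x₀)
  have hip' : ∀ (k : Fin n) (t : ℝ), inner ℝ (e k) (x₀ + t • e m)
      = inner ℝ (e k) x₀ + t * (if k = m then 1 else 0) := fun k t => by
    rw [inner_add_right, inner_smul_right, e.inner_eq_ite]
  have h1 : ∀ᶠ t : ℝ in 𝓝 0, HasDerivAt (fun t : ℝ => hessTrace e u (x₀ + t • e m))
      (dirDeriv (e m) (hessTrace e u) (x₀ + t • e m)) t := by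
    filter_upwards [hmem] with t ht using hasDerivAt_line_of_mem hs hW (by norm_num) ht
  have h1' := hasDerivAt_line_of_mem hs hW' (by norm_num) hmem0
  have h2 : ∀ᶠ t : ℝ in 𝓝 0, HasDerivAt (fun t : ℝ => ∑ k, (inner ℝ (e k) x₀
        + t * (if k = m then 1 else 0)) * dirDeriv (e k) u (x₀ + t • e m) - u (x₀ + t • e m))
      (∑ k, (inner ℝ (e k) x₀ + t * (if k = m then 1 else 0)) * hess e u k m (x₀ + t • e m)) t := by
    filter_upwards [hmem] with t ht
    have := (HasDerivAt.fun_sum fun k (_ : k ∈ Finset.univ) => (hip k t).mul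
      (hasDerivAt_line_of_mem hs (contDiffOn_frame_one (e := e) hs hu k) (by norm_num) ht)).sub
      (hasDerivAt_line_of_mem hs hu (by norm_num) ht)
    convert! this using 1
    simp [Finset.sum_add_distrib, hess]
  have h2' : HasDerivAt (fun t : ℝ => ∑ k, (inner ℝ (e k) x₀
        + t * (if k = m then 1 else 0)) * hess e u k m (x₀ + t • e m))
      (lam m + ∑ k, inner ℝ (e k) x₀ * thirdDeriv e u k m m x₀) 0 := by
    have := (HasDerivAt.fun_sum fun k (_ : k ∈ Finset.univ) => (hip k 0).mul
      (hasDerivAt_line_of_mem hs (contDiffOn_hess (e := e) hs hu k m) (by norm_num) hmem0))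
    convert! this using 1
    simp [Finset.sum_add_distrib, hlam, thirdDeriv]
  have h3 : ∀ᶠ t : ℝ in 𝓝 0, HasDerivAt
      (fun t : ℝ => (∑ k, dirDeriv (e k) u (x₀ + t • e m) ^ 2) / 2)
      (∑ k, dirDeriv (e k) u (x₀ + t • e m) * hess e u k m (x₀ + t • e m)) t := by
    filter_upwards [hmem] with t ht
    have := (HasDerivAt.fun_sum fun k (_ : k ∈ Finset.univ) =>
      (hasDerivAt_line_of_mem hs (contDiffOn_frame_one (e := e) hs hu k)
        (by norm_num) ht).pow 2).div_const 2
    convert! this using 1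
    simp only [mul_assoc, ← Finset.mul_sum, Nat.cast_ofNat, Nat.add_one_sub_one, pow_one]
    rw [mul_div_cancel_left₀ _ (two_ne_zero)]
    rfl
  have h3' : HasDerivAt (fun t : ℝ => ∑ k, dirDeriv (e k) u (x₀ + t • e m)
        * hess e u k m (x₀ + t • e m))
      (lam m ^ 2 + ∑ k, dirDeriv (e k) u x₀ * thirdDeriv e u k m m x₀) 0 := by
    have := (HasDerivAt.fun_sum fun k (_ : k ∈ Finset.univ) =>
      (hasDerivAt_line_of_mem hs (contDiffOn_frame_one (e := e) hs hu k)
        (by norm_num) hmem0).mul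
      (hasDerivAt_line_of_mem hs (contDiffOn_hess (e := e) hs hu k m) (by norm_num) hmem0))
    convert! this using 1
    have c : dirDeriv (e m) (dirDeriv (e m) u) x₀ = lam m := by simpa [hess] using hlam m m
    simp [Finset.sum_add_distrib, c, hlam, thirdDeriv, sq]
  have hρ : ‖x₀‖ ^ 2 < 9 := by
    have := norm_nonneg x₀
    nlinarith
  have hZ : ∀ t : ℝ, fderiv ℝ u (x₀ + t • e m) (x₀ + t • e m) - u (x₀ + t • e m)
      = ∑ k, (inner ℝ (e k) x₀ + t * (if k = m then 1 else 0)) * dirDeriv (e k) u (x₀ + t • e m)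
        - u (x₀ + t • e m) := fun t => by
    rw [clm_apply_eq_sum e]
    simp only [hip']
    rfl
  have hY : ∀ x, ‖fderiv ℝ u x‖ ^ 2 / 2 = (∑ k, dirDeriv (e k) u x ^ 2) / 2 := fun x => by
    rw [← sum_sq_clm_apply e]; rfl
  have hN : ∀ t : ℝ, ‖x₀ + t • e m‖ ^ 2 = ‖x₀‖ ^ 2 + 2 * t * inner ℝ (e m) x₀ + t ^ 2 := fun t => by
    rw [norm_add_sq_real, inner_smul_right, norm_smul, e.orthonormal.1 m, real_inner_comm]
    simp; ring
  have hmaxl : IsLocalMax (fun t : ℝ => Real.log (hessTrace e u (x₀ + t • e m))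
      - (9 / (9 - (‖x₀‖ ^ 2 + 2 * t * inner ℝ (e m) x₀ + t ^ 2))) ^ 2 * (N
        - a * (∑ k, (inner ℝ (e k) x₀ + t * (if k = m then 1 else 0))
          * dirDeriv (e k) u (x₀ + t • e m) - u (x₀ + t • e m))
        - B * ((∑ k, dirDeriv (e k) u (x₀ + t • e m) ^ 2) / 2))) 0 := by
    have hc : ContinuousAt (fun t : ℝ => x₀ + t • e m) 0 := by fun_prop
    have h0 : IsLocalMax (testFunction N a B (hessTrace e u) u)
        ((fun t : ℝ => x₀ + t • e m) 0) := by
      simpa using hmax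
    have := h0.comp_continuous (f := testFunction N a B (hessTrace e u) u)
      (g := fun t : ℝ => x₀ + t • e m) (b := 0) hc
    convert this using 1
    funext t
    simp only [Function.comp, testFunction]
    rw [hZ, hY, hN]
  have H := line_max_conditions hρ (by simpa using hw) h1 h1' h2 h2' h3 h3' hmaxl
  have hZ0 := hZ 0
  simp only [zero_smul, add_zero, zero_mul] at H hZ0
  rw [← hZ0, ← hY] at H
  simp only [hlam, mul_ite, mul_zero, Finset.sum_ite_eq', Finset.mem_univ, if_true] at H
  constructor
  · rw [H.1]; ring
  · refine le_trans (le_of_eq ?_) H.2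
    ring

/-- Summing the directional second-order conditions with the weights `f`, when the contractions of
`f` with `lam` and with `T` are known. -/
theorem sum_weighted_contract (f lam X D P Q S G : Fin n → ℝ) (T : Fin n → Fin n → ℝ)
    (γ E c r a B : ℝ) (hfl : ∑ i, f i * lam i = γ) (hfT : ∀ k, ∑ i, f i * T k i = G k) :
    ∑ i, f i * (P i - E * Q i + c * S i + r * (a * (lam i + ∑ k, X k * T k i)
        + B * (lam i ^ 2 + ∑ k, D k * T k i)))
      = ∑ i, f i * P i - E * ∑ i, f i * Q i + c * ∑ i, f i * S i
        + r * (a * (γ + ∑ k, X k * G k) + B * (∑ i, f i * lam i ^ 2 + ∑ k, D k * G k)) := by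
  have hc : ∀ X : Fin n → ℝ, ∑ k, X k * G k = ∑ i, f i * ∑ k, X k * T k i := by
    intro X
    simp only [← hfT, Finset.mul_sum]
    rw [Finset.sum_comm]
    exact Finset.sum_congr rfl fun i _ => Finset.sum_congr rfl fun k _ => by ring
  rw [hc X, hc D, ← hfl]
  have h : ∀ i, f i * (P i - E * Q i + c * S i + r * (a * (lam i + ∑ k, X k * T k i)
        + B * (lam i ^ 2 + ∑ k, D k * T k i)))
      = f i * P i - E * (f i * Q i) + c * (f i * S i) + (r * a) * (f i * lam i)
        + (r * a) * (f i * ∑ k, X k * T k i) + (r * B) * (f i * lam i ^ 2)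
        + (r * B) * (f i * ∑ k, D k * T k i) := fun i => by ring
  simp only [h, Finset.sum_add_distrib, Finset.sum_sub_distrib, ← Finset.mul_sum]
  ring

/-- The linearized operator applied to the test function is nonpositive at a maximum. The third
derivatives of `u` have been eliminated through the differentiated equation. -/
theorem testFunction_max_inequality {N a B : ℝ} (hs : IsOpen s) (hu : ContDiffOn ℝ 4 u s)
    (hg : ContDiffOn ℝ 2 g s) (hx₀ : x₀ ∈ s) (hx₃ : ‖x₀‖ < 3) (hw : 0 < hessTrace e u x₀)
    (hg₀ : 0 < g x₀)
    (heq : ∀ x ∈ s, hessTrace e u x ^ 2 - ∑ i, ∑ j, hess e u i j x ^ 2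
      = 2 * g x * hessTrace e u x) {lam : Fin n → ℝ}
    (hlam : ∀ i j, hess e u i j x₀ = if i = j then lam i else 0)
    (h1 : ∑ i, lam i = hessTrace e u x₀)
    (h2 : ∑ i, lam i ^ 2 = hessTrace e u x₀ ^ 2 - 2 * g x₀ * hessTrace e u x₀)
    (hmax : IsLocalMax (testFunction N a B (hessTrace e u) u) x₀) :
    ∑ i, (1 - g x₀ / hessTrace e u x₀ - lam i / hessTrace e u x₀) *
        (dirDeriv (e i) (dirDeriv (e i) (hessTrace e u)) x₀ / hessTrace e u x₀
          - (dirDeriv (e i) (hessTrace e u) x₀ / hessTrace e u x₀) ^ 2)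
      - (N - a * (fderiv ℝ u x₀ x₀ - u x₀) - B * (‖fderiv ℝ u x₀‖ ^ 2 / 2)) *
        ∑ i, (1 - g x₀ / hessTrace e u x₀ - lam i / hessTrace e u x₀) *
        (4 / 9 * (9 / (9 - ‖x₀‖ ^ 2)) ^ 3
          + 8 / 27 * (9 / (9 - ‖x₀‖ ^ 2)) ^ 4 * (inner ℝ (e i) x₀) ^ 2)
      + 8 / 9 * (9 / (9 - ‖x₀‖ ^ 2)) ^ 3 *
        ∑ i, (1 - g x₀ / hessTrace e u x₀ - lam i / hessTrace e u x₀) * (inner ℝ (e i) x₀ *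
        (a * inner ℝ (e i) x₀ + B * dirDeriv (e i) u x₀) * lam i)
      + (9 / (9 - ‖x₀‖ ^ 2)) ^ 2 *
        (a * (g x₀ + ∑ k, inner ℝ (e k) x₀ * dirDeriv (e k) g x₀)
          + B * (∑ i, (1 - g x₀ / hessTrace e u x₀ - lam i / hessTrace e u x₀) * lam i ^ 2
            + ∑ k, dirDeriv (e k) u x₀ * dirDeriv (e k) g x₀)) ≤ 0 := by
  have hD := (differentiated_equation_diagonal hs hu hg hx₀ heq hw hlam).1
  have hf := coeff_pos hw hg₀ h2
  have hfl : ∑ i, (1 - g x₀ / hessTrace e u x₀ - lam i / hessTrace e u x₀) * lam i = g x₀ := by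
    have : ∀ i, (1 - g x₀ / hessTrace e u x₀ - lam i / hessTrace e u x₀) * lam i
        = (1 - g x₀ / hessTrace e u x₀) * lam i - lam i ^ 2 / hessTrace e u x₀ := fun i => by ring
    simp only [this]
    rw [Finset.sum_sub_distrib, ← Finset.mul_sum, ← Finset.sum_div, h1, h2]
    field_simp
    ring
  have hfT : ∀ k, ∑ i, (1 - g x₀ / hessTrace e u x₀ - lam i / hessTrace e u x₀) *
      thirdDeriv e u k i i x₀ = dirDeriv (e k) g x₀ := by
    intro k
    have hsymm : ∀ i, thirdDeriv e u k i i x₀ = thirdDeriv e u i i k x₀ := fun i => by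
      rw [thirdDeriv_symm_left hs hu k i i hx₀, thirdDeriv_symm_right hs hu i k i hx₀]
    have : ∀ i, (1 - g x₀ / hessTrace e u x₀ - lam i / hessTrace e u x₀) * thirdDeriv e u k i i x₀
        = (1 - g x₀ / hessTrace e u x₀) * thirdDeriv e u i i k x₀
          - (lam i * thirdDeriv e u i i k x₀) / hessTrace e u x₀ := fun i => by
      rw [hsymm]; ring
    simp only [this]
    rw [Finset.sum_sub_distrib, ← Finset.mul_sum, ← Finset.sum_div, hD,
      dirDeriv_hessTrace hs hu k hx₀]
    field_simp
    ring
  have hm := Finset.sum_nonpos fun m (_ : m ∈ Finset.univ) => mul_nonpos_of_nonneg_of_nonpos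
    (hf m).le (testFunction_max_conditions hs hu hx₀ hx₃ hw hlam hmax m).2
  exact (sum_weighted_contract _ lam (fun k => inner ℝ (e k) x₀) (fun k => dirDeriv (e k) u x₀)
    _ _ _ (fun k => dirDeriv (e k) g x₀) (fun k i => thirdDeriv e u k i i x₀)
    _ _ _ _ _ _ hfl hfT).symm.trans_le hm

end TestFunction

/-! ### The equation in an orthonormal frame -/

theorem sigma_one {n : ℕ} (lam : Fin n → ℝ) : sigma 1 lam = ∑ i, lam i := by
  simp [sigma, Finset.powersetCard_one]

theorem two_mul_sum_powersetCard_two {ι : Type*} (s : Finset ι) (lam : ι → ℝ) :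
    2 * ∑ t ∈ Finset.powersetCard 2 s, ∏ i ∈ t, lam i
      = (∑ i ∈ s, lam i) ^ 2 - ∑ i ∈ s, lam i ^ 2 := by
  classical
  induction s using Finset.induction_on with
  | empty => rw [Finset.powersetCard_eq_empty.2 (by simp)]; simp
  | insert a s ha ih =>
    rw [Finset.powersetCard_succ_insert ha, Finset.sum_union, Finset.sum_image, mul_add, ih,
      Finset.sum_insert ha, Finset.sum_insert ha]
    · have : ∑ t ∈ Finset.powersetCard 1 s, ∏ i ∈ insert a t, lam i
          = lam a * ∑ i ∈ s, lam i := by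
        rw [Finset.powersetCard_one, Finset.sum_map, Finset.mul_sum]
        refine Finset.sum_congr rfl fun i hi => ?_
        have hne : a ≠ i := fun h => ha (h ▸ hi)
        simp [Finset.prod_pair hne]
      rw [this]; ring
    · intro t ht t' ht' h
      have h1 : a ∉ t := fun h => ha ((Finset.mem_powersetCard.1 ht).1 h)
      have h2 : a ∉ t' := fun h => ha ((Finset.mem_powersetCard.1 ht').1 h)
      rw [← Finset.erase_insert h1, ← Finset.erase_insert h2]
      exact congrArg (fun q => Finset.erase q a) h
    · rw [Finset.disjoint_left]
      intro t ht ht'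
      obtain ⟨q, -, rfl⟩ := Finset.mem_image.1 ht'
      exact ha ((Finset.mem_powersetCard.1 ht).1 (Finset.mem_insert_self a q))

theorem two_mul_sigma_two {n : ℕ} (lam : Fin n → ℝ) :
    2 * sigma 2 lam = (∑ i, lam i) ^ 2 - ∑ i, lam i ^ 2 :=
  two_mul_sum_powersetCard_two _ _

section Frames

variable {n : ℕ} {u : EuclideanSpace ℝ (Fin n) → ℝ} {s : Set (EuclideanSpace ℝ (Fin n))}
  {x : EuclideanSpace ℝ (Fin n)}

/-- The entries of `hess` are those of the bilinear form `D²u`. -/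
theorem hess_eq_fderiv (hs : IsOpen s) (hu : ContDiffOn ℝ 2 u s) (hx : x ∈ s)
    (e : Fin n → EuclideanSpace ℝ (Fin n)) (i j : Fin n) :
    hess e u i j x = fderiv ℝ (fderiv ℝ u) x (e j) (e i) :=
  dirDeriv_dirDeriv hs hu hx

theorem sum_sq_bilinear_eq (Q : EuclideanSpace ℝ (Fin n) →L[ℝ] EuclideanSpace ℝ (Fin n) →L[ℝ] ℝ)
    (e e' : OrthonormalBasis (Fin n) ℝ (EuclideanSpace ℝ (Fin n))) :
    ∑ i, ∑ j, Q (e j) (e i) ^ 2 = ∑ i, ∑ j, Q (e' j) (e' i) ^ 2 := by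
  calc ∑ i, ∑ j, Q (e j) (e i) ^ 2 = ∑ i, ∑ j, Q.flip (e i) (e j) ^ 2 := rfl
    _ = ∑ i, ∑ j, Q.flip (e i) (e' j) ^ 2 := by simp only [sum_sq_clm_apply]
    _ = ∑ j, ∑ i, Q (e' j) (e i) ^ 2 := by rw [Finset.sum_comm]; rfl
    _ = ∑ j, ∑ i, Q (e' j) (e' i) ^ 2 := by simp only [sum_sq_clm_apply]
    _ = _ := Finset.sum_comm

theorem hessTrace_eq_laplacian (hs : IsOpen s) (hu : ContDiffOn ℝ 2 u s)
    (e : OrthonormalBasis (Fin n) ℝ (EuclideanSpace ℝ (Fin n))) :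
    EqOn (hessTrace e u) (Laplacian.laplacian u) s := fun x hx => by
  rw [InnerProductSpace.laplacian_eq_iteratedFDeriv_orthonormalBasis u e]
  simp only [hessTrace, hess_eq_fderiv hs hu hx, iteratedFDeriv_two_apply]
  simp

/-- At each point some orthonormal frame diagonalizes the Hessian, with the entries of
`eigenvalueVector` on the diagonal. -/
theorem exists_eigenframe (hs : IsOpen s) (hu : ContDiffOn ℝ 2 u s) (hx : x ∈ s) :
    ∃ e : OrthonormalBasis (Fin n) ℝ (EuclideanSpace ℝ (Fin n)),
      ∀ i j, hess e u i j x = if i = j then eigenvalueVector (hessian u x) i else 0 := by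
  have hA : (hessian u x).IsHermitian := hessian_isHermitian (hu.contDiffAt (hs.mem_nhds hx))
  have he : eigenvalueVector (hessian u x) = hA.eigenvalues := by
    rw [eigenvalueVector, dif_pos hA]
  refine ⟨hA.eigenvectorBasis, fun i j => ?_⟩
  rw [he, hess_eq_fderiv hs hu hx]
  have hexp : ∀ v z : EuclideanSpace ℝ (Fin n), fderiv ℝ (fderiv ℝ u) x v z
      = ∑ k, z k * ((hessian u x).mulVec v) k := by
    intro v z
    rw [clm_apply_eq_sum (EuclideanSpace.basisFun (Fin n) ℝ)]
    refine Finset.sum_congr rfl fun k _ => ?_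
    rw [EuclideanSpace.basisFun_inner]
    congr 1
    have hsymm := (hu.contDiffAt (hs.mem_nhds hx)).isSymmSndFDerivAt (by simp)
    rw [hsymm, clm_apply_eq_sum (EuclideanSpace.basisFun (Fin n) ℝ)]
    simp only [EuclideanSpace.basisFun_inner]
    simp [Matrix.mulVec, dotProduct, hessian, iteratedFDeriv_two_apply, mul_comm]
  rw [hexp, hA.mulVec_eigenvectorBasis]
  have hon := hA.eigenvectorBasis.inner_eq_ite i j
  rw [PiLp.inner_apply] at hon
  simp only [RCLike.inner_apply, conj_trivial] at hon
  calc ∑ k, hA.eigenvectorBasis i k * (hA.eigenvalues j • ⇑(hA.eigenvectorBasis j)) k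
      = hA.eigenvalues j * ∑ k, hA.eigenvectorBasis j k * hA.eigenvectorBasis i k := by
        rw [Finset.mul_sum]
        refine Finset.sum_congr rfl fun k _ => ?_
        simp; ring
    _ = _ := by
        rw [hon]
        split_ifs with h
        · rw [h]; ring
        · ring

theorem hessTrace_eq_sum_eigenvalueVector (hs : IsOpen s) (hu : ContDiffOn ℝ 2 u s) (hx : x ∈ s)
    (e : OrthonormalBasis (Fin n) ℝ (EuclideanSpace ℝ (Fin n))) :
    hessTrace e u x = ∑ i, eigenvalueVector (hessian u x) i := by
  obtain ⟨e', he'⟩ := exists_eigenframe hs hu hx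
  rw [hessTrace_eq_laplacian hs hu e hx, ← hessTrace_eq_laplacian hs hu e' hx]
  simp [hessTrace, he']

theorem sum_sq_hess_eq_sum_sq_eigenvalueVector (hs : IsOpen s) (hu : ContDiffOn ℝ 2 u s)
    (hx : x ∈ s) (e : OrthonormalBasis (Fin n) ℝ (EuclideanSpace ℝ (Fin n))) :
    ∑ i, ∑ j, hess e u i j x ^ 2 = ∑ i, eigenvalueVector (hessian u x) i ^ 2 := by
  obtain ⟨e', he'⟩ := exists_eigenframe hs hu hx
  have h := sum_sq_bilinear_eq (fderiv ℝ (fderiv ℝ u) x) e e'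
  simp only [← hess_eq_fderiv hs hu hx] at h
  rw [h]
  simp [he', ite_pow]

end Frames

section Solution

variable {n : ℕ} {u : EuclideanSpace ℝ (Fin n) → ℝ} {ψ : EuclideanSpace ℝ (Fin n) × ℝ → ℝ}
  {s : Set (EuclideanSpace ℝ (Fin n))} {x : EuclideanSpace ℝ (Fin n)}

/-- In dimension less than two `σ₂` vanishes, so there are no `2`-convex functions. -/
theorem IsTwoConvexSolutionOn.two_le (h : IsTwoConvexSolutionOn ψ u s) (hx : x ∈ s) : 2 ≤ n := by
  by_contra! hn
  have h2 := h.twoConvex.2 x hx 2 (by norm_num) le_rfl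
  rw [sigma, Finset.powersetCard_eq_empty.2 (by simpa using hn)] at h2
  simp at h2

theorem IsTwoConvexSolutionOn.hessTrace_pos (h : IsTwoConvexSolutionOn ψ u s) (hs : IsOpen s)
    (hx : x ∈ s) (e : OrthonormalBasis (Fin n) ℝ (EuclideanSpace ℝ (Fin n))) :
    0 < hessTrace e u x := by
  have h2 := h.twoConvex.2 x hx 1 le_rfl (by norm_num)
  rwa [sigma_one, ← hessTrace_eq_sum_eigenvalueVector hs h.twoConvex.1 hx e] at h2

/-- The equation in a fixed orthonormal frame, cleared of denominators: `σ₁² - |D²u|² = 2 ψ σ₁`. -/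
theorem IsTwoConvexSolutionOn.frame_equation (h : IsTwoConvexSolutionOn ψ u s) (hs : IsOpen s)
    (hx : x ∈ s) (e : OrthonormalBasis (Fin n) ℝ (EuclideanSpace ℝ (Fin n))) :
    hessTrace e u x ^ 2 - ∑ i, ∑ j, hess e u i j x ^ 2
      = 2 * ψ (x, u x) * hessTrace e u x := by
  have h1 := h.hessTrace_pos hs hx e
  have h2 := h.equation x hx
  rw [sigma_one, ← hessTrace_eq_sum_eigenvalueVector hs h.twoConvex.1 hx e,
    div_eq_iff h1.ne'] at h2
  rw [mul_assoc, ← h2, two_mul_sigma_two, ← hessTrace_eq_sum_eigenvalueVector hs h.twoConvex.1 hx e,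
    ← sum_sq_hess_eq_sum_sq_eigenvalueVector hs h.twoConvex.1 hx e]

/-- Although `ψ` is only `C^{1,1}`, the composition `ψ(x, u(x))` is `C²`, because it equals
`σ₂/σ₁` of the Hessian of a `C⁴` function. -/
theorem IsTwoConvexSolutionOn.contDiffOn_rhs (h : IsTwoConvexSolutionOn ψ u s) (hs : IsOpen s) :
    ContDiffOn ℝ 2 (fun x => ψ (x, u x)) s := by
  have e := EuclideanSpace.basisFun (Fin n) ℝ
  have h1 : ContDiffOn ℝ 2 (fun x => (hessTrace e u x ^ 2 - ∑ i, ∑ j, hess e u i j x ^ 2)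
      / (2 * hessTrace e u x)) s := by
    have hW := contDiffOn_hessTrace (e := e) hs h.contDiffOn
    refine ContDiffOn.div ((hW.pow 2).sub (ContDiffOn.sum fun i _ => ContDiffOn.sum fun j _ =>
      (contDiffOn_hess hs h.contDiffOn i j).pow 2)) (contDiffOn_const.mul hW) fun x hx => ?_
    have := h.hessTrace_pos hs hx e
    positivity
  refine h1.congr fun x hx => ?_
  have := h.hessTrace_pos hs hx e
  rw [h.frame_equation hs hx e]
  field_simp

end Solution

/-! ### Derivatives of the right-hand side -/

section RightHandSide

variable {n : ℕ} {u : EuclideanSpace ℝ (Fin n) → ℝ} {ψ : EuclideanSpace ℝ (Fin n) × ℝ → ℝ}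
  {x v : EuclideanSpace ℝ (Fin n)} {M K r : ℝ}

theorem dirDeriv_comp_graph (hψ : DifferentiableAt ℝ ψ (x, u x)) (hu : DifferentiableAt ℝ u x) :
    dirDeriv v (fun y => ψ (y, u y)) x = fderiv ℝ ψ (x, u x) (v, dirDeriv v u x) := by
  have h1 : HasFDerivAt (fun y => (y, u y)) ((ContinuousLinearMap.id ℝ _).prod (fderiv ℝ u x)) x :=
    (hasFDerivAt_id x).prodMk hu.hasFDerivAt
  have h2 := hψ.hasFDerivAt.comp x h1
  rw [dirDeriv, show (fun y => ψ (y, u y)) = ψ ∘ fun y => (y, u y) from rfl, h2.fderiv]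
  rfl

theorem abs_dirDeriv_le (hu : C1Bound u (ball 0 r) M) (hx : x ∈ ball 0 r) (hv : ‖v‖ = 1) :
    |dirDeriv v u x| ≤ M := by
  have := (fderiv ℝ u x).le_opNorm v
  rw [hv, mul_one, Real.norm_eq_abs] at this
  exact this.trans (hu x hx).2

theorem norm_graph_direction_le (hu : C1Bound u (ball 0 r) M) (hx : x ∈ ball 0 r) (hv : ‖v‖ = 1) :
    ‖((v, dirDeriv v u x) : EuclideanSpace ℝ (Fin n) × ℝ)‖ ≤ 1 + M := by
  have h1 := abs_dirDeriv_le hu hx hv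
  have h2 := abs_nonneg (dirDeriv v u x)
  rw [Prod.norm_def, hv]
  exact max_le (by linarith) (by rw [Real.norm_eq_abs]; linarith)

theorem graph_mem (hu : C1Bound u (ball 0 r) M) (hx : x ∈ ball 0 r) :
    (x, u x) ∈ ball (0 : EuclideanSpace ℝ (Fin n)) r ×ˢ Icc (-M) M :=
  ⟨hx, abs_le.1 (hu x hx).1⟩

theorem abs_dirDeriv_comp_graph_le (hu : C1Bound u (ball 0 r) M)
    (hψ : C11Bound ψ (ball 0 r ×ˢ Icc (-M) M) K) (hud : DifferentiableOn ℝ u (ball 0 r))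
    (hx : x ∈ ball 0 r) (hv : ‖v‖ = 1) :
    |dirDeriv v (fun y => ψ (y, u y)) x| ≤ K * (1 + M) := by
  have hz := graph_mem hu hx
  obtain ⟨h1, -, h2⟩ := hψ.1 _ hz
  rw [dirDeriv_comp_graph h1 (hud.differentiableAt (isOpen_ball.mem_nhds hx)), ← Real.norm_eq_abs]
  calc _ ≤ ‖fderiv ℝ ψ (x, u x)‖ * ‖((v, dirDeriv v u x) : EuclideanSpace ℝ (Fin n) × ℝ)‖ :=
        ContinuousLinearMap.le_opNorm _ _
    _ ≤ _ := mul_le_mul h2 (norm_graph_direction_le hu hx hv) (norm_nonneg _)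
      ((norm_nonneg _).trans h2)

/-- The second derivatives of `ψ(x, u(x))` grow at most linearly in `D²u`. They are bounded through
difference quotients of the first derivatives, since `Dψ` is only Lipschitz. -/
theorem abs_dirDeriv_dirDeriv_comp_graph_le (hu : C1Bound u (ball 0 r) M)
    (hψ : C11Bound ψ (ball 0 r ×ˢ Icc (-M) M) K) (hu2 : ContDiffOn ℝ 2 u (ball 0 r))
    (hg2 : ContDiffOn ℝ 2 (fun y => ψ (y, u y)) (ball 0 r))
    (hx : x ∈ ball 0 r) (hv : ‖v‖ = 1) :
    |dirDeriv v (dirDeriv v (fun y => ψ (y, u y))) x|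
      ≤ K * (1 + M) ^ 2 + K * |dirDeriv v (dirDeriv v u) x| := by
  have hud : DifferentiableOn ℝ u (ball 0 r) := hu2.differentiableOn (by norm_num)
  have hM : 0 ≤ M := (abs_nonneg _).trans (hu x hx).1
  have hK : 0 ≤ K := (abs_nonneg _).trans (hψ.1 _ (graph_mem hu hx)).2.1
  have hx0 : x + (0 : ℝ) • v ∈ ball 0 r := by simpa using hx
  have h1 := hasDerivAt_line_of_mem isOpen_ball
    (contDiffOn_dirDeriv isOpen_ball hg2 (m := 1) (by norm_num) v) (by norm_num) hx0
  have h2 := hasDerivAt_line_of_mem isOpen_ball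
    (contDiffOn_dirDeriv isOpen_ball hu2 (m := 1) (by norm_num) v) (by norm_num) hx0
  rw [hasDerivAt_iff_tendsto_slope] at h1 h2
  simp only [zero_smul, add_zero] at h1 h2
  refine le_of_tendsto_of_tendsto h1.abs ((h2.abs.const_mul K).const_add _) ?_
  filter_upwards [nhdsWithin_le_nhds (eventually_line_mem isOpen_ball hx v),
    self_mem_nhdsWithin] with t ht ht0
  have ht0' : 0 < |t| := abs_pos.2 ht0
  have hslope : ∀ q : ℝ → ℝ, |slope q 0 t| = |q t - q 0| / |t| := fun q => by
    rw [slope_def_field, sub_zero, abs_div]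
  rw [hslope, hslope, div_le_iff₀ ht0', add_mul, mul_assoc K (_ / _), div_mul_cancel₀ _ ht0'.ne']
  simp only [zero_smul, add_zero]
  rw [dirDeriv_comp_graph (hψ.1 _ (graph_mem hu ht)).1
      (hud.differentiableAt (isOpen_ball.mem_nhds ht)),
    dirDeriv_comp_graph (hψ.1 _ (graph_mem hu hx)).1
      (hud.differentiableAt (isOpen_ball.mem_nhds hx))]
  have hlip : |u (x + t • v) - u x| ≤ M * |t| := by
    have := (convex_ball (0 : EuclideanSpace ℝ (Fin n)) r).norm_image_sub_le_of_norm_fderiv_le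
      (fun y hy => hud.differentiableAt (isOpen_ball.mem_nhds hy)) (fun y hy => (hu y hy).2) hx ht
    simpa [norm_smul, hv] using this
  have hz : ‖((x + t • v, u (x + t • v)) : EuclideanSpace ℝ (Fin n) × ℝ) - (x, u x)‖
      ≤ (1 + M) * |t| := by
    rw [Prod.mk_sub_mk, Prod.norm_def]
    refine max_le ?_ ?_
    · simp only [add_sub_cancel_left, norm_smul, hv, mul_one, Real.norm_eq_abs]
      nlinarith
    · simp only [Real.norm_eq_abs]; linarith
  have e1 : fderiv ℝ ψ (x + t • v, u (x + t • v)) (v, dirDeriv v u (x + t • v))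
      - fderiv ℝ ψ (x, u x) (v, dirDeriv v u x)
      = (fderiv ℝ ψ (x + t • v, u (x + t • v)) - fderiv ℝ ψ (x, u x))
          (v, dirDeriv v u (x + t • v))
        + fderiv ℝ ψ (x, u x) (0, dirDeriv v u (x + t • v) - dirDeriv v u x) := by
    have : ((0, dirDeriv v u (x + t • v) - dirDeriv v u x) : EuclideanSpace ℝ (Fin n) × ℝ)
        = (v, dirDeriv v u (x + t • v)) - (v, dirDeriv v u x) := by simp
    rw [this, map_sub, sub_apply]
    ring
  rw [e1]
  refine (abs_add_le _ _).trans (add_le_add ?_ ?_)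
  · rw [← Real.norm_eq_abs]
    calc _ ≤ ‖fderiv ℝ ψ (x + t • v, u (x + t • v)) - fderiv ℝ ψ (x, u x)‖
          * ‖((v, dirDeriv v u (x + t • v)) : EuclideanSpace ℝ (Fin n) × ℝ)‖ :=
          ContinuousLinearMap.le_opNorm _ _
      _ ≤ (K * ((1 + M) * |t|)) * (1 + M) := by
          gcongr
          · exact (hψ.2 _ (graph_mem hu ht) _ (graph_mem hu hx)).trans (by gcongr)
          · exact norm_graph_direction_le hu ht hv
      _ = _ := by ring
  · rw [← Real.norm_eq_abs]
    calc _ ≤ ‖fderiv ℝ ψ (x, u x)‖ * ‖((0, dirDeriv v u (x + t • v) - dirDeriv v u x) :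
          EuclideanSpace ℝ (Fin n) × ℝ)‖ := ContinuousLinearMap.le_opNorm _ _
      _ ≤ _ := by
        rw [Prod.norm_def]
        simp only [norm_zero, Real.norm_eq_abs]
        rw [max_eq_right (abs_nonneg _)]
        gcongr
        exact (hψ.1 _ (graph_mem hu hx)).2.2

end RightHandSide

/-! ### Semi-convexity -/

/-- Semi-convexity bounds the second derivatives from below; the function is restricted to a line
and symmetrized. -/
theorem SemiconvexOnWith.neg_two_mul_le {n : ℕ} {u : EuclideanSpace ℝ (Fin n) → ℝ} {A : ℝ}
    {s : Set (EuclideanSpace ℝ (Fin n))} {x v : EuclideanSpace ℝ (Fin n)}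
    (h : SemiconvexOnWith A u s) (hs : IsOpen s) (hu : ContDiffOn ℝ 2 u s) (hx : x ∈ s)
    (hv : ‖v‖ = 1) : -(2 * A) ≤ dirDeriv v (dirDeriv v u) x := by
  have hconv : ConvexOn ℝ s fun x => u x + A * ‖x‖ ^ 2 := h
  have hmem := eventually_line_mem hs hx v
  have hneg : Filter.Tendsto (fun t : ℝ => -t) (𝓝 0) (𝓝 0) := by
    simpa using (continuous_neg (G := ℝ)).tendsto 0
  have hmem' := hneg.eventually hmem
  have hx0 : x + (0 : ℝ) • v ∈ s := by simpa using hx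
  have hu1 : ContDiffOn ℝ 1 (dirDeriv v u) s := contDiffOn_dirDeriv hs hu (by norm_num) v
  have h1 : ∀ᶠ t : ℝ in 𝓝 0, HasDerivAt (fun t : ℝ => -(u (x + t • v) + u (x + (-t) • v))
      - 2 * A * t ^ 2)
      (-(dirDeriv v u (x + t • v) - dirDeriv v u (x + (-t) • v)) - 4 * A * t) t := by
    filter_upwards [hmem, hmem'] with t ht ht'
    have a1 := hasDerivAt_line_of_mem hs hu (by norm_num) ht
    have a2 := (hasDerivAt_line_of_mem hs hu (by norm_num) ht').comp t (hasDerivAt_neg t)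
    have := (a1.add a2).neg.sub ((hasDerivAt_pow 2 t).const_mul (2 * A))
    convert! this using 1
    simp; ring
  have h2 : HasDerivAt (fun t : ℝ => -(dirDeriv v u (x + t • v) - dirDeriv v u (x + (-t) • v))
      - 4 * A * t) (-(2 * dirDeriv v (dirDeriv v u) x) - 4 * A) 0 := by
    have a1 := hasDerivAt_line_of_mem hs hu1 (by norm_num) hx0
    have hx0' : x + (-(0 : ℝ)) • v ∈ s := by simpa using hx
    have a2 := (hasDerivAt_line_of_mem hs hu1 (by norm_num) hx0').comp (0 : ℝ) (hasDerivAt_neg 0)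
    have := (a1.sub a2).neg.sub ((hasDerivAt_id (0 : ℝ)).const_mul (4 * A))
    convert! this using 1
    simp; ring
  have hmax : IsLocalMax (fun t : ℝ => -(u (x + t • v) + u (x + (-t) • v)) - 2 * A * t ^ 2) 0 := by
    filter_upwards [hmem, hmem'] with t ht ht'
    have hc := hconv.2 ht ht' (by norm_num : (0 : ℝ) ≤ 1 / 2)
      (by norm_num : (0 : ℝ) ≤ 1 / 2) (by norm_num)
    have hmid : (1 / 2 : ℝ) • (x + t • v) + (1 / 2 : ℝ) • (x + (-t) • v) = x := by module
    have hn := parallelogram_law_with_norm ℝ x (t • v)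
    have hn1 : x - t • v = x + (-t) • v := by module
    rw [hn1, norm_smul, hv] at hn
    simp only [mul_one, Real.norm_eq_abs, sq_abs] at hn
    simp only [hmid, smul_eq_mul] at hc
    simp only [zero_smul, add_zero, neg_zero]
    have h5 : A * ‖x + t • v‖ ^ 2 + A * ‖x + (-t) • v‖ ^ 2 = 2 * (A * ‖x‖ ^ 2) + 2 * A * t ^ 2 := by
      linear_combination A * hn
    linarith
  have := (deriv_eq_zero_of_isLocalMax_and_nonpos h1 h2 hmax).2
  linarith

/-! ### The doubling inequality -/

/-- The parameters of the test function. They are `a = A t`, `N = t²` with `A` large depending on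
`ε` and `L`, then `B` a large multiple of `A²`, and finally `t` large. -/
theorem exists_testFunction_parameters {n : ℕ} {M L ε C C₂ : ℝ} (hn : 1 ≤ n) (hM : 0 ≤ M)
    (hL : 0 < L) (hε : 0 < ε) (hC : 0 ≤ C) (hC₂ : 0 ≤ C₂) :
    ∃ a B N : ℝ, 0 < a ∧ 0 < B ∧ 1 ≤ N ∧ 4 * (B * M) ≤ a ∧ a ^ 2 ≤ B * N ∧ (a + B) * C₂ ≤ N ∧
      C ≤ N ∧ 181440 * n ^ 2 / ε ≤ N ∧ 5806080 * n ^ 2 * a ^ 2 ≤ B * N ∧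
      8960 * n ^ 3 * L ^ 2 * N / ε < a ^ 2 ∧ a * (4 * M) + B * M ^ 2 ≤ N / 2 := by
  have hn' : (1 : ℝ) ≤ n := by exact_mod_cast hn
  -- `A ≤ A ^ 2` turns this choice into the strict lower bound required of `a ^ 2`
  obtain ⟨A, hA⟩ : ∃ A : ℝ, A = 8960 * n ^ 3 * L ^ 2 / ε + 1 := ⟨_, rfl⟩
  have hA0 : 0 ≤ 8960 * n ^ 3 * L ^ 2 / ε := by positivity
  have hA1 : 1 ≤ A := by linarith
  obtain ⟨B, hB⟩ : ∃ B : ℝ, B = 5806080 * n ^ 2 * A ^ 2 := ⟨_, rfl⟩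
  have hB0 : 0 < B := by rw [hB]; positivity
  have p1 : 0 ≤ 4 * (B * M) := by positivity
  have p2 : 0 ≤ (A + B) * C₂ := by positivity
  have p3 : 0 ≤ 181440 * n ^ 2 / ε := by positivity
  have p4 : 0 ≤ 2 * (4 * M * A + B * M ^ 2) := by positivity
  obtain ⟨t, ht⟩ : ∃ t : ℝ, t = 1 + 4 * (B * M) + (A + B) * C₂ + C + 181440 * n ^ 2 / ε
      + 2 * (4 * M * A + B * M ^ 2) := ⟨_, rfl⟩
  have ht1 : 1 ≤ t := by linarith
  have ht0 : 0 < t := by linarith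
  have htt : t ≤ t ^ 2 := le_self_pow₀ ht1 (by norm_num)
  have hAt : t ≤ A * t := le_mul_of_one_le_left ht0.le hA1
  refine ⟨A * t, B, t ^ 2, by positivity, hB0, one_le_pow₀ ht1, by linarith, ?_, ?_, by linarith,
    by linarith, ?_, ?_, ?_⟩
  · have : A ^ 2 ≤ B := by
      rw [hB]
      have h1 : (1 : ℝ) ≤ n ^ 2 := one_le_pow₀ hn'
      nlinarith [sq_nonneg A]
    rw [mul_pow]; gcongr
  · calc (A * t + B) * C₂ ≤ (A * t + B * t) * C₂ := by
          gcongr; exact le_mul_of_one_le_right hB0.le ht1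
      _ = (A + B) * C₂ * t := by ring
      _ ≤ t * t := by gcongr; linarith
      _ = _ := by ring
  · rw [hB]; exact le_of_eq (by ring)
  · have h1 : 8960 * n ^ 3 * L ^ 2 / ε < A ^ 2 := by
      have : A ≤ A ^ 2 := le_self_pow₀ hA1 (by norm_num)
      linarith
    calc 8960 * n ^ 3 * L ^ 2 * t ^ 2 / ε = 8960 * n ^ 3 * L ^ 2 / ε * t ^ 2 := by ring
      _ < A ^ 2 * t ^ 2 := by gcongr
      _ = _ := by ring
  · have h1 : B * M ^ 2 ≤ B * M ^ 2 * t := le_mul_of_one_le_right (by positivity) ht1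
    have h2 : 2 * (4 * M * A + B * M ^ 2) * t ≤ t * t := by gcongr; linarith
    linarith

section Doubling

variable {n : ℕ} {u : EuclideanSpace ℝ (Fin n) → ℝ} {ψ : EuclideanSpace ℝ (Fin n) × ℝ → ℝ}

theorem nine_sub_norm_sq_pos {x : EuclideanSpace ℝ (Fin n)} (hx : ‖x‖ < 3) :
    0 < 9 - ‖x‖ ^ 2 := by
  have := norm_nonneg x
  nlinarith

theorem one_le_cutoff {x : EuclideanSpace ℝ (Fin n)} (hx : ‖x‖ < 3) :
    1 ≤ 9 / (9 - ‖x‖ ^ 2) := by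
  rw [le_div_iff₀ (nine_sub_norm_sq_pos hx)]
  linarith [sq_nonneg ‖x‖]

theorem abs_gradient_terms_le {M : ℝ} {x : EuclideanSpace ℝ (Fin n)} {a B : ℝ} (ha : 0 ≤ a)
    (hB : 0 ≤ B) (hu : C1Bound u (ball 0 3) M) (hx : x ∈ ball 0 3) :
    |a * (fderiv ℝ u x x - u x) + B * (‖fderiv ℝ u x‖ ^ 2 / 2)| ≤ a * (4 * M) + B * M ^ 2 := by
  obtain ⟨h1, h2⟩ := hu x hx
  have hx' : ‖x‖ ≤ 3 := (mem_ball_zero_iff.1 hx).le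
  have h3 : |fderiv ℝ u x x| ≤ M * 3 := by
    rw [← Real.norm_eq_abs]
    exact ((fderiv ℝ u x).le_opNorm x).trans
      (mul_le_mul h2 hx' (norm_nonneg _) ((norm_nonneg _).trans h2))
  have h4 : ‖fderiv ℝ u x‖ ^ 2 ≤ M ^ 2 := pow_le_pow_left₀ (norm_nonneg _) h2 2
  have h5 : |fderiv ℝ u x x - u x| ≤ 4 * M := (abs_sub _ _).trans (by linarith)
  refine (abs_add_le _ _).trans (add_le_add ?_ ?_)
  · rw [abs_mul, abs_of_nonneg ha]; gcongr
  · rw [abs_of_nonneg (by positivity)]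
    have := sq_nonneg ‖fderiv ℝ u x‖
    gcongr; linarith

/-- The test function attains its maximum over the open ball of radius `3`, because it tends to `-∞`
at the boundary. -/
theorem exists_testFunction_max {M a B N : ℝ} {w : EuclideanSpace ℝ (Fin n) → ℝ} (hN : 0 < N)
    (ha : 0 ≤ a) (hB : 0 ≤ B) (hNab : a * (4 * M) + B * M ^ 2 ≤ N / 2)
    (hu : C1Bound u (ball 0 3) M) (hu1 : ContDiffOn ℝ 1 u (ball 0 3))
    (hw : ContinuousOn w (closedBall 0 3)) (hw0 : ∀ x ∈ closedBall 0 3, 0 < w x) :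
    ∃ x₀ ∈ ball (0 : EuclideanSpace ℝ (Fin n)) 3, ∀ x ∈ ball 0 3,
      testFunction N a B w u x ≤ testFunction N a B w u x₀ := by
  have hlog : ContinuousOn (fun x => Real.log (w x)) (closedBall 0 3) :=
    hw.log fun x hx => (hw0 x hx).ne'
  obtain ⟨b, hb⟩ := (isCompact_closedBall (0 : EuclideanSpace ℝ (Fin n)) 3).bddAbove_image hlog
  have hb' : ∀ x ∈ ball (0 : EuclideanSpace ℝ (Fin n)) 3, Real.log (w x) ≤ b := fun x hx =>
    hb (mem_image_of_mem _ (ball_subset_closedBall hx))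
  obtain ⟨p, hp⟩ : ∃ p, p = testFunction N a B w u 0 := ⟨_, rfl⟩
  -- where `9 / (9 - ‖x‖ ^ 2)` exceeds `H + 1`, the test function is at most its value `p` at the
  -- origin; the complement is the closed ball of radius `√(9 - 9 / (H + 1))`
  obtain ⟨H, hH⟩ : ∃ H : ℝ, H = max (2 / N * (b - p)) 0 := ⟨_, rfl⟩
  have hH0 : 0 ≤ H := hH ▸ le_max_right _ _
  have hlt : √(9 - 9 / (H + 1)) < 3 := by
    rw [Real.sqrt_lt' (by norm_num)]
    have : 0 < 9 / (H + 1) := by positivity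
    linarith
  have hsub : closedBall (0 : EuclideanSpace ℝ (Fin n)) (√(9 - 9 / (H + 1))) ⊆ ball 0 3 :=
    closedBall_subset_ball hlt
  have hcont : ContinuousOn (testFunction N a B w u)
      (closedBall (0 : EuclideanSpace ℝ (Fin n)) (√(9 - 9 / (H + 1)))) := by
    have hfd : ContinuousOn (fderiv ℝ u) (ball 0 3) :=
      (hu1.fderiv_of_isOpen isOpen_ball (m := 0) (by norm_num)).continuousOn
    have h1 : ContinuousOn (fun x : EuclideanSpace ℝ (Fin n) => 9 / (9 - ‖x‖ ^ 2)) (ball 0 3) :=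
      ContinuousOn.div (by fun_prop) (by fun_prop) fun x hx =>
        (nine_sub_norm_sq_pos (mem_ball_zero_iff.1 hx)).ne'
    have h2 := hu1.continuousOn
    have h3 : ContinuousOn (testFunction N a B w u) (ball 0 3) := by
      unfold testFunction
      refine ContinuousOn.sub (hlog.mono ball_subset_closedBall) ((h1.pow 2).mul ?_)
      exact (continuousOn_const.sub (continuousOn_const.mul ((hfd.clm_apply continuousOn_id).sub
        h2))).sub (continuousOn_const.mul ((hfd.norm.pow 2).div_const 2))
    exact h3.mono hsub
  obtain ⟨x₀, hx₀, hmax⟩ := (isCompact_closedBall (0 : EuclideanSpace ℝ (Fin n)) _).exists_isMaxOn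
    ⟨0, mem_closedBall_self (Real.sqrt_nonneg _)⟩ hcont
  refine ⟨x₀, hsub hx₀, fun x hx => ?_⟩
  by_cases hxr : x ∈ closedBall (0 : EuclideanSpace ℝ (Fin n)) (√(9 - 9 / (H + 1)))
  · exact hmax hxr
  · refine le_trans ?_ (hmax (mem_closedBall_self (Real.sqrt_nonneg _)))
    rw [← hp]
    by_contra! hlt
    apply hxr
    have h1 := hb' x hx
    have h2 := le_of_abs_le (abs_gradient_terms_le ha hB hu hx)
    have h3 := nine_sub_norm_sq_pos (mem_ball_zero_iff.1 hx)
    have hR1 := one_le_cutoff (mem_ball_zero_iff.1 hx)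
    have h4 : (9 / (9 - ‖x‖ ^ 2)) ^ 2 * (N / 2) ≤ b - p := by
      have h5 : (9 / (9 - ‖x‖ ^ 2)) ^ 2 * (N / 2) ≤ (9 / (9 - ‖x‖ ^ 2)) ^ 2 *
          (N - a * (fderiv ℝ u x x - u x) - B * (‖fderiv ℝ u x‖ ^ 2 / 2)) := by
        gcongr; linarith
      unfold testFunction at hlt
      linarith
    have h6 : 9 / (9 - ‖x‖ ^ 2) ≤ H + 1 := by
      have h7 : (9 / (9 - ‖x‖ ^ 2)) ^ 2 ≤ 2 / N * (b - p) := by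
        calc (9 / (9 - ‖x‖ ^ 2)) ^ 2 = 2 / N * ((9 / (9 - ‖x‖ ^ 2)) ^ 2 * (N / 2)) := by field_simp
          _ ≤ _ := by gcongr
      have h8 : 9 / (9 - ‖x‖ ^ 2) ≤ (9 / (9 - ‖x‖ ^ 2)) ^ 2 := le_self_pow₀ hR1 (by norm_num)
      have h9 : 2 / N * (b - p) ≤ H := hH ▸ le_max_left _ _
      linarith
    rw [mem_closedBall_zero_iff]
    apply Real.le_sqrt_of_sq_le
    rw [div_le_iff₀ h3] at h6
    rw [le_sub_comm, div_le_iff₀ (by positivity)]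
    linarith

/-- At a maximum point of the test function outside the unit ball, `Δu` is bounded by a multiple of
`R⁴`. -/
theorem laplacian_le_at_max (hn : 2 ≤ n) {M K L Λ₀ : ℝ} (hM : 0 ≤ M) (hK : 0 ≤ K) (hL : 0 < L) :
    ∃ a B N Λ : ℝ, 0 < a ∧ 0 < B ∧ 1 ≤ N ∧ a * (4 * M) + B * M ^ 2 ≤ N / 2 ∧ 1 ≤ Λ ∧
      ∀ (ψ : EuclideanSpace ℝ (Fin n) × ℝ → ℝ) (u : EuclideanSpace ℝ (Fin n) → ℝ),
        IsAdmissible M K L ψ u →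
        (∀ x ∈ ball 0 3, Λ₀ ≤ Laplacian.laplacian u x →
          ∀ i, -cConst n * Laplacian.laplacian u x ≤ eigenvalueVector (hessian u x) i) →
        ∀ x₀ ∈ ball (0 : EuclideanSpace ℝ (Fin n)) 3, 1 ≤ ‖x₀‖ →
          IsLocalMax (testFunction N a B (Laplacian.laplacian u) u) x₀ →
          Laplacian.laplacian u x₀ ≤ Λ * (9 / (9 - ‖x₀‖ ^ 2)) ^ 4 := by
  have hn1 : 1 ≤ n := by omega
  have hc := cConst_pos hn
  obtain ⟨ε, hε, C, hC, W, hW, HJ⟩ := jacobi_inequality hn (K := K) (G := K * (1 + M))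
    (C₀ := n * (K * (1 + M) ^ 2 + K)) hK (by positivity)
  obtain ⟨C₂, hC₂⟩ : ∃ C₂ : ℝ, C₂ = K + n * (3 * (K * (1 + M))) + n * (M * (K * (1 + M))) :=
    ⟨_, rfl⟩
  have hC₂0 : 0 ≤ C₂ := by rw [hC₂]; positivity
  obtain ⟨a, B, N, ha, hB, hN1, hBM, haB, haC, hCN, hNε, hBa, haL, hab⟩ :=
    exists_testFunction_parameters hn1 hM hL hε hC hC₂0
  have hN0 : 0 < N := by linarith
  have q1 : 0 ≤ 16 / (B * cConst n ^ 2) * (140 * n * N + 2 * n * C * (3 * N + 4 * a) ^ 2) := by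
    positivity
  have q2 : 0 ≤ 16 * n * N / a := by positivity
  have q3 := abs_nonneg Λ₀
  -- `Λ` is the sum of the lower bounds for `Δu` that the separate steps require
  refine ⟨a, B, N, W + |Λ₀| + 16 / (B * cConst n ^ 2) *
    (140 * n * N + 2 * n * C * (3 * N + 4 * a) ^ 2) + 16 * n * N / a, ha, hB, hN1, hab,
    by linarith, ?_⟩
  intro ψ u hadm hlow x₀ hx₀ hx1 hmax
  by_contra! hbig
  have hx3 : ‖x₀‖ < 3 := mem_ball_zero_iff.1 hx₀
  have hx4 : x₀ ∈ ball (0 : EuclideanSpace ℝ (Fin n)) 4 := ball_subset_ball (by norm_num) hx₀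
  have hs : IsOpen (ball (0 : EuclideanSpace ℝ (Fin n)) 4) := isOpen_ball
  have hsol := hadm.solution
  have hu := hsol.contDiffOn
  have hu2 := hsol.twoConvex.1
  obtain ⟨e, he⟩ := exists_eigenframe hs hu2 hx4
  have hwl := hessTrace_eq_laplacian hs hu2 e
  have hpos := hsol.hessTrace_pos hs hx4 e
  have hg := hsol.contDiffOn_rhs hs
  have heq := fun x (hx : x ∈ ball (0 : EuclideanSpace ℝ (Fin n)) 4) =>
    hsol.frame_equation hs hx e
  rw [← hwl hx4] at hbig
  have hlow' : Λ₀ ≤ hessTrace e u x₀ →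
      ∀ i, -cConst n * hessTrace e u x₀ ≤ eigenvalueVector (hessian u x₀) i := by
    rw [hwl hx4]; exact hlow x₀ hx₀
  have hmax' : IsLocalMax (testFunction N a B (hessTrace e u) u) x₀ := by
    refine hmax.congr ?_
    filter_upwards [hs.mem_nhds hx4] with y hy
    simp only [testFunction, hwl hy]
  generalize eigenvalueVector (hessian u x₀) = lam at he hlow'
  have hsum1 : ∑ i, lam i = hessTrace e u x₀ := by simp [hessTrace, he]
  have hsum2 : ∑ i, lam i ^ 2 = hessTrace e u x₀ ^ 2
      - 2 * ψ (x₀, u x₀) * hessTrace e u x₀ := by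
    rw [← heq x₀ hx4]
    simp [he, ite_pow]
  have hg0 : 0 < ψ (x₀, u x₀) := hadm.psi_pos x₀ hx4 _
  have hgm := graph_mem hadm.u_bound hx₀
  have hgK : ψ (x₀, u x₀) ≤ K := (le_abs_self _).trans (hadm.psi_bound.1 _ hgm).2.1
  have hgL : 1 / L ≤ ψ (x₀, u x₀) := by
    have := hadm.inv_psi_bound _ hgm
    rwa [one_div_le hL hg0]
  have h43 : ball (0 : EuclideanSpace ℝ (Fin n)) 3 ⊆ ball 0 4 := ball_subset_ball (by norm_num)
  have hd : ∀ i, |dirDeriv (e i) u x₀| ≤ M := fun i =>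
    abs_dirDeriv_le hadm.u_bound hx₀ (e.orthonormal.1 i)
  have hg' : ∀ i, |dirDeriv (e i) (fun x => ψ (x, u x)) x₀| ≤ K * (1 + M) := fun i =>
    abs_dirDeriv_comp_graph_le hadm.u_bound hadm.psi_bound
      ((hu2.mono h43).differentiableOn (by norm_num)) hx₀ (e.orthonormal.1 i)
  have hg'' : ∀ i, |dirDeriv (e i) (dirDeriv (e i) (fun x => ψ (x, u x))) x₀|
      ≤ K * (1 + M) ^ 2 + K * |lam i| := fun i => by
    have := abs_dirDeriv_dirDeriv_comp_graph_le hadm.u_bound hadm.psi_bound (hu2.mono h43)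
      (hg.mono h43) hx₀ (e.orthonormal.1 i)
    have h2 : dirDeriv (e i) (dirDeriv (e i) u) x₀ = lam i := by simpa [hess] using he i i
    rwa [h2] at this
  have hxi : ∀ i, |inner ℝ (e i) x₀| ≤ 3 := fun i =>
    (abs_real_inner_le_norm _ _).trans (by rw [e.orthonormal.1 i, one_mul]; exact hx3.le)
  have hxsum : ∑ i, (inner ℝ (e i) x₀) ^ 2 = ‖x₀‖ ^ 2 := by
    rw [← e.sum_sq_norm_inner_right]
    simp
  have hxs1 : 1 ≤ ∑ i, (inner ℝ (e i) x₀) ^ 2 := by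
    rw [hxsum]; exact one_le_pow₀ hx1
  have hR1 := one_le_cutoff hx3
  have hE := abs_le.1 (abs_gradient_terms_le ha.le hB.le hadm.u_bound hx₀)
  have hDE := differentiated_equation_diagonal hs hu hg hx4 heq hpos he
  have hMI := testFunction_max_inequality hs hu hg hx4 hx3 hpos hg0 heq he hsum1 hsum2 hmax'
  have hMC := fun m => (testFunction_max_conditions hs hu hx4 hx3 hpos he hmax' m).1
  have hv : ∀ m, ∑ i, thirdDeriv e u i i m x₀ = dirDeriv (e m) (hessTrace e u) x₀ := fun m =>
    (dirDeriv_hessTrace hs hu m hx4).symm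
  generalize 9 / (9 - ‖x₀‖ ^ 2) = R at *
  have hR4 : 1 ≤ R ^ 4 := one_le_pow₀ hR1
  have hbig' : ∀ q : ℝ, 0 ≤ q → q ≤ W + |Λ₀| + 16 / (B * cConst n ^ 2) *
      (140 * n * N + 2 * n * C * (3 * N + 4 * a) ^ 2) + 16 * n * N / a →
      q * R ^ 4 < hessTrace e u x₀ := fun q _ hq2 =>
    lt_of_le_of_lt (mul_le_mul_of_nonneg_right hq2 (by positivity)) hbig
  have hbig1 : ∀ q : ℝ, 0 ≤ q → q ≤ W + |Λ₀| + 16 / (B * cConst n ^ 2) *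
      (140 * n * N + 2 * n * C * (3 * N + 4 * a) ^ 2) + 16 * n * N / a →
      q < hessTrace e u x₀ := fun q hq1 hq2 =>
    lt_of_le_of_lt (le_mul_of_one_le_right hq1 hR4) (hbig' q hq1 hq2)
  have hWw : W ≤ hessTrace e u x₀ := (hbig1 W (by linarith) (by linarith)).le
  have hΛw : Λ₀ ≤ hessTrace e u x₀ :=
    (le_abs_self _).trans (hbig1 |Λ₀| q3 (by linarith)).le
  have hw1 : 1 ≤ hessTrace e u x₀ := hW.trans hWw
  have hlamw := abs_le_of_sum_sq hpos hg0 hsum2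
  have hg₂ : |∑ m, dirDeriv (e m) (dirDeriv (e m) (fun x => ψ (x, u x))) x₀|
      ≤ n * (K * (1 + M) ^ 2 + K) * hessTrace e u x₀ := by
    calc _ ≤ ∑ m, |dirDeriv (e m) (dirDeriv (e m) (fun x => ψ (x, u x))) x₀| :=
          Finset.abs_sum_le_sum_abs _ _
      _ ≤ ∑ _m : Fin n, (K * (1 + M) ^ 2 + K) * hessTrace e u x₀ := by
          refine Finset.sum_le_sum fun i _ => (hg'' i).trans ?_
          rw [add_mul]
          exact add_le_add (le_mul_of_one_le_right (by positivity) hw1)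
            (mul_le_mul_of_nonneg_left (hlamw i) hK)
      _ = _ := by simp; ring
  have HJ' := HJ lam (fun i => dirDeriv (e i) (hessTrace e u) x₀)
    (fun i => dirDeriv (e i) (fun x => ψ (x, u x)) x₀)
    (fun i => dirDeriv (e i) (dirDeriv (e i) (hessTrace e u)) x₀)
    (fun i j k => thirdDeriv e u i j k x₀) (hessTrace e u x₀) (ψ (x₀, u x₀)) _ hWw hg0 hgK hg' hg₂
    hsum1 hsum2 (fun i j k => thirdDeriv_symm_left hs hu i j k hx4)
    (fun i j k => thirdDeriv_symm_right hs hu i j k hx4) hv hDE.1 hDE.2 (hlow' hΛw)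
  have hsumb : ∀ (c d : ℝ) (p q : Fin n → ℝ), 0 ≤ c → (∀ i, |p i| ≤ c) → (∀ i, |q i| ≤ d) →
      |∑ i, p i * q i| ≤ n * (c * d) := by
    intro c d p q hc hp hq
    calc |∑ i, p i * q i| ≤ ∑ i, |p i * q i| := Finset.abs_sum_le_sum_abs _ _
      _ ≤ ∑ _i : Fin n, c * d := Finset.sum_le_sum fun i _ => by
          rw [abs_mul]; exact mul_le_mul (hp i) (hq i) (abs_nonneg _) hc
      _ = _ := by simp
  have s1 := hsumb 3 (K * (1 + M)) (fun i => inner ℝ (e i) x₀) _ (by norm_num) hxi hg'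
  have s2 := hsumb M (K * (1 + M)) (fun i => dirDeriv (e i) u x₀) _ hM hd hg'
  have hG₁ : |ψ (x₀, u x₀) + ∑ k, inner ℝ (e k) x₀ * dirDeriv (e k) (fun x => ψ (x, u x)) x₀|
      ≤ C₂ := by
    refine (abs_add_le _ _).trans ?_
    rw [abs_of_pos hg0, hC₂]
    have : 0 ≤ n * (M * (K * (1 + M))) := by positivity
    linarith
  have hG₂ : |∑ k, dirDeriv (e k) u x₀ * dirDeriv (e k) (fun x => ψ (x, u x)) x₀| ≤ C₂ := by
    rw [hC₂]
    have : 0 ≤ n * (3 * (K * (1 + M))) := by positivity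
    linarith
  obtain ⟨E, hEdef⟩ : ∃ E, E = N - a * (fderiv ℝ u x₀ x₀ - u x₀) - B * (‖fderiv ℝ u x₀‖ ^ 2 / 2) :=
    ⟨_, rfl⟩
  rw [← hEdef] at hMI
  simp only [← hEdef] at hMC
  have hE1 : N / 2 ≤ E := by linarith [hE.2]
  have hE2 : E ≤ 2 * N := by linarith [hE.1]
  have hBM' : B * M ≤ a := by
    have : 0 ≤ B * M := by positivity
    linarith
  by_cases hbad : ∃ k, lam k < -(cConst n / 2) * hessTrace e u x₀
  · obtain ⟨k, hk⟩ := hbad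
    have hstar := maximum_inequality hn1 hpos hg0 hsum2 hR1 hd hxi (by linarith) hE2 ha hB hBM' haB
      haC hCN hG₁ hG₂ HJ'.1 hMI
    have := le_of_very_negative_eigenvalue hw1 hg0 hsum2 hR1 hd hxi (by linarith) hE2 ha hB hBM'
      hc hC hMC hstar hk
    exact absurd this (not_le.2 (hbig' _ q1 (by linarith)))
  · push Not at hbad
    have hstar := maximum_inequality hn1 hpos hg0 hsum2 hR1 hd hxi (by linarith) hE2 ha hB hBM' haB
      haC hCN hG₁ hG₂ (HJ'.2 hbad) hMI
    have := le_of_gradient_control hn1 hpos hg0 hL hgL hsum1 hsum2 hR1 hd hxi hxs1 hN0 hE1 hE2 ha hB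
      hBM hε hNε hBa haL hMC hstar
    exact absurd this (not_le.2 (hbig' _ q2 (by linarith)))

/-- The doubling inequality, under a lower bound on the eigenvalues of the Hessian that is needed
only where `Δu` is at least some `Λ₀`. -/
theorem exists_doubling_constant (hn : 2 ≤ n) {M K L Λ₀ : ℝ} (hM : 0 ≤ M) (hK : 0 ≤ K)
    (hL : 0 < L) :
    ∃ C : ℝ, 0 < C ∧
      ∀ (ψ : EuclideanSpace ℝ (Fin n) × ℝ → ℝ) (u : EuclideanSpace ℝ (Fin n) → ℝ),
        IsAdmissible M K L ψ u →
        (∀ x ∈ ball 0 3, Λ₀ ≤ Laplacian.laplacian u x →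
          ∀ i, -cConst n * Laplacian.laplacian u x ≤ eigenvalueVector (hessian u x) i) →
        DoublingInequality u C := by
  obtain ⟨a, B, N, Λ, ha, hB, hN, hab, hΛ, H⟩ := laplacian_le_at_max hn (Λ₀ := Λ₀) hM hK hL
  refine ⟨Real.exp (7 * N) * (1 + Λ * Real.exp 8), by positivity, ?_⟩
  intro ψ u hadm hlow
  have hs : IsOpen (ball (0 : EuclideanSpace ℝ (Fin n)) 4) := isOpen_ball
  have hsol := hadm.solution
  have hwl := hessTrace_eq_laplacian hs hsol.twoConvex.1 (EuclideanSpace.basisFun (Fin n) ℝ)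
  have hcont : ContinuousOn (Laplacian.laplacian u) (ball 0 4) :=
    (contDiffOn_hessTrace hs hsol.contDiffOn).continuousOn.congr hwl.symm
  have hpos : ∀ x ∈ ball (0 : EuclideanSpace ℝ (Fin n)) 4, 0 < Laplacian.laplacian u x :=
    fun x hx => hwl hx ▸ hsol.hessTrace_pos hs hx _
  have h34 : closedBall (0 : EuclideanSpace ℝ (Fin n)) 3 ⊆ ball 0 4 :=
    closedBall_subset_ball (by norm_num)
  have hbdd : ∀ r ≤ 3, BddAbove (Laplacian.laplacian u '' ball (0 : EuclideanSpace ℝ (Fin n)) r) :=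
    fun r hr => ((isCompact_closedBall _ _).bddAbove_image (hcont.mono h34)).mono
      (image_mono ((ball_subset_ball hr).trans ball_subset_closedBall))
  obtain ⟨x₀, hx₀, hmax⟩ := exists_testFunction_max (by linarith) ha.le hB.le hab hadm.u_bound
    ((hsol.contDiffOn.mono (ball_subset_closedBall.trans h34)).of_le (by norm_num))
    (hcont.mono h34) fun x hx => hpos x (h34 hx)
  have hlocal : IsLocalMax (testFunction N a B (Laplacian.laplacian u) u) x₀ := by
    filter_upwards [isOpen_ball.mem_nhds hx₀] with x hx using hmax x hx
  obtain ⟨m, hm⟩ : ∃ m, m = sSup (Laplacian.laplacian u '' ball (0 : EuclideanSpace ℝ (Fin n)) 1) :=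
    ⟨_, rfl⟩
  have hm1 : ∀ x ∈ ball (0 : EuclideanSpace ℝ (Fin n)) 1, Laplacian.laplacian u x ≤ m :=
    fun x hx => hm ▸ le_csSup (hbdd 1 (by norm_num)) (mem_image_of_mem _ hx)
  have hm0 : 0 < m := (hpos 0 (mem_ball_self (by norm_num))).trans_le
    (hm1 0 (mem_ball_self (by norm_num)))
  refine ⟨hbdd 2 (by norm_num), ?_⟩
  rw [← hm]
  refine csSup_le ((nonempty_ball.2 (by norm_num)).image _) ?_
  rintro _ ⟨x, hx, rfl⟩
  have hx3 : x ∈ ball (0 : EuclideanSpace ℝ (Fin n)) 3 := ball_subset_ball (by norm_num) hx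
  have hx4 : x ∈ ball (0 : EuclideanSpace ℝ (Fin n)) 4 := ball_subset_ball (by norm_num) hx
  have hx04 := h34 (ball_subset_closedBall hx₀)
  -- in the ball of radius `2` the cutoff is at most `9 / 5`, and `(9 / 5) ^ 2 * (3 / 2) ≤ 7`
  have hlow2 : Real.log (Laplacian.laplacian u x) - 7 * N
      ≤ testFunction N a B (Laplacian.laplacian u) u x := by
    have hE := abs_le.1 (abs_gradient_terms_le ha.le hB.le hadm.u_bound hx3)
    have h1 : ‖x‖ ^ 2 ≤ 4 := by
      have := (mem_ball_zero_iff.1 hx).le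
      have := norm_nonneg x
      nlinarith
    have h2 : 0 < 9 - ‖x‖ ^ 2 := by linarith
    have h3 : 9 / (9 - ‖x‖ ^ 2) ≤ 9 / 5 := by
      apply div_le_div_of_nonneg_left <;> linarith
    have h4 : (9 / (9 - ‖x‖ ^ 2)) ^ 2 *
        (N - a * (fderiv ℝ u x x - u x) - B * (‖fderiv ℝ u x‖ ^ 2 / 2))
        ≤ (9 / 5) ^ 2 * (3 / 2 * N) := by
      apply mul_le_mul
      · gcongr
      · linarith [hE.1]
      · linarith [hE.2]
      · positivity
    unfold testFunction
    linarith
  have hup : testFunction N a B (Laplacian.laplacian u) u x₀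
      ≤ Real.log (Laplacian.laplacian u x₀) - (9 / (9 - ‖x₀‖ ^ 2)) ^ 2 * (N / 2) := by
    have hE := abs_le.1 (abs_gradient_terms_le ha.le hB.le hadm.u_bound hx₀)
    unfold testFunction
    gcongr
    linarith [hE.2]
  have hchain := hlow2.trans ((hmax x hx3).trans hup)
  have hR1 := one_le_cutoff (mem_ball_zero_iff.1 hx₀)
  have hw0 := hpos x₀ hx04
  have hexp : ∀ q : ℝ, 0 < q → Real.log (Laplacian.laplacian u x) ≤ 7 * N + Real.log q →
      Laplacian.laplacian u x ≤ Real.exp (7 * N) * q := fun q hq h => by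
    rw [← Real.exp_log (hpos x hx4), ← Real.exp_log hq, Real.exp_log (hpos x hx4), ← Real.exp_add,
      ← Real.log_le_iff_le_exp (hpos x hx4)]
    exact h
  -- inside the unit ball `Δu(x₀)` is controlled by its supremum there; outside it, `Δu(x₀) ≤ Λ R⁴`,
  -- and the term `-R² N / 2` of the test function absorbs `4 log R`
  rcases lt_or_ge ‖x₀‖ 1 with hlt | hge
  · have h1 : Real.log (Laplacian.laplacian u x₀) ≤ Real.log m :=
      Real.log_le_log hw0 (hm1 x₀ (mem_ball_zero_iff.2 hlt))
    have h2 : 0 ≤ (9 / (9 - ‖x₀‖ ^ 2)) ^ 2 * (N / 2) := by positivity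
    refine (hexp m hm0 (by linarith)).trans ?_
    rw [mul_assoc]
    gcongr
    have : 0 ≤ Λ * Real.exp 8 := by positivity
    nlinarith
  · have h1 := H ψ u hadm hlow x₀ hx₀ hge hlocal
    generalize 9 / (9 - ‖x₀‖ ^ 2) = R at *
    have hR0 : 0 < R := by linarith
    have h2 : Real.log (Laplacian.laplacian u x₀) ≤ Real.log Λ + 4 * Real.log R := by
      refine (Real.log_le_log hw0 h1).trans (le_of_eq ?_)
      rw [Real.log_mul (by linarith) (by positivity), Real.log_pow]
      simp
    have h3 := Real.log_le_sub_one_of_pos hR0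
    have h4 : R ^ 2 * (1 / 2) ≤ R ^ 2 * (N / 2) := by gcongr
    have h5 : Real.log Λ + 8 = Real.log (Λ * Real.exp 8) := by
      rw [Real.log_mul (by linarith) (Real.exp_pos 8).ne', Real.log_exp]
    refine (hexp (Λ * Real.exp 8) (by positivity) ?_).trans ?_
    · rw [← h5]
      linarith [sq_nonneg (R - 4)]
    · rw [mul_assoc]
      refine mul_le_mul_of_nonneg_left ?_ (Real.exp_pos _).le
      have : 0 ≤ Λ * Real.exp 8 := by positivity
      nlinarith

end Doubling

end HessianQuotient

open HessianQuotient in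
theorem theorem3p1 (n : ℕ) (M K L : ℝ) :
    (∃ C : ℝ, 0 < C ∧
      ∀ (ψ : EuclideanSpace ℝ (Fin n) × ℝ → ℝ) (u : EuclideanSpace ℝ (Fin n) → ℝ),
        HessianQuotient.IsAdmissible M K L ψ u →
        HessianQuotient.DynamicSemiconvexOn u (ball 0 4) →
        HessianQuotient.DoublingInequality u C) ∧
    (∀ A : ℝ, 0 < A → ∃ C : ℝ, 0 < C ∧
      ∀ (ψ : EuclideanSpace ℝ (Fin n) × ℝ → ℝ) (u : EuclideanSpace ℝ (Fin n) → ℝ),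
        HessianQuotient.IsAdmissible M K L ψ u →
        HessianQuotient.SemiconvexOnWith A u (ball 0 4) →
        HessianQuotient.DoublingInequality u C) := by
  -- the signs of the constants and `2 ≤ n` follow from the existence of admissible data
  by_cases hex : ∃ (ψ : EuclideanSpace ℝ (Fin n) × ℝ → ℝ) (u : EuclideanSpace ℝ (Fin n) → ℝ),
    IsAdmissible M K L ψ u
  swap
  · push Not at hex
    exact ⟨⟨1, one_pos, fun ψ u h => absurd h (hex ψ u)⟩,
      fun A _ => ⟨1, one_pos, fun ψ u h => absurd h (hex ψ u)⟩⟩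
  obtain ⟨ψ₀, u₀, h₀⟩ := hex
  have h03 : (0 : EuclideanSpace ℝ (Fin n)) ∈ ball 0 3 := mem_ball_self (by norm_num)
  have h04 : (0 : EuclideanSpace ℝ (Fin n)) ∈ ball 0 4 := mem_ball_self (by norm_num)
  have hn : 2 ≤ n := h₀.solution.two_le h04
  have hM : 0 ≤ M := (abs_nonneg _).trans (h₀.u_bound 0 h03).1
  have hK : 0 ≤ K := (abs_nonneg _).trans (h₀.psi_bound.1 _ (graph_mem h₀.u_bound h03)).2.1
  have hL : 0 < L := (one_div_pos.2 (h₀.psi_pos 0 h04 (u₀ 0))).trans_le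
    (h₀.inv_psi_bound _ (graph_mem h₀.u_bound h03))
  have hs : IsOpen (ball (0 : EuclideanSpace ℝ (Fin n)) 4) := isOpen_ball
  have h34 : ball (0 : EuclideanSpace ℝ (Fin n)) 3 ⊆ ball 0 4 := ball_subset_ball (by norm_num)
  have hpos : ∀ (ψ : EuclideanSpace ℝ (Fin n) × ℝ → ℝ) (u : EuclideanSpace ℝ (Fin n) → ℝ),
      IsAdmissible M K L ψ u → ∀ x ∈ ball (0 : EuclideanSpace ℝ (Fin n)) 4,
        0 < Laplacian.laplacian u x := fun ψ u h x hx =>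
    hessTrace_eq_laplacian hs h.solution.twoConvex.1 (EuclideanSpace.basisFun (Fin n) ℝ) hx ▸
      h.solution.hessTrace_pos hs hx _
  constructor
  · obtain ⟨C, hC, H⟩ := exists_doubling_constant hn (Λ₀ := 0) hM hK hL
    refine ⟨C, hC, fun ψ u hadm hdyn => H ψ u hadm fun x hx _ i => ?_⟩
    have h1 := hdyn x (h34 hx)
    rw [le_div_iff₀ (hpos ψ u hadm x (h34 hx))] at h1
    exact h1.trans (ciInf_le (Set.finite_range _).bddBelow i)
  · intro A hA
    have hc := cConst_pos hn
    -- where `Δu ≥ 2A / cₙ`, semi-convexity gives `λᵢ ≥ -2A ≥ -cₙ Δu`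
    obtain ⟨C, hC, H⟩ := exists_doubling_constant hn (Λ₀ := 2 * A / cConst n) hM hK hL
    refine ⟨C, hC, fun ψ u hadm hconv => H ψ u hadm fun x hx hx' i => ?_⟩
    rw [div_le_iff₀ hc] at hx'
    obtain ⟨e, he⟩ := exists_eigenframe hs hadm.solution.twoConvex.1 (h34 hx)
    have h1 := hconv.neg_two_mul_le hs hadm.solution.twoConvex.1 (h34 hx) (e.orthonormal.1 i)
    have h2 : dirDeriv (e i) (dirDeriv (e i) u) x = eigenvalueVector (hessian u x) i := by
      simpa [hess] using he i i
    rw [h2] at h1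
    linarith
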